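/- Let $\Omega_n=\{0,1\}^n$ with the coordinatewise order and the uniform probability measure $\mu$. For $x\in\Omega_n$ let $x\oplus e_k$ be $x$ with its $k$-th coordinate $x_k$ replaced by $1-x_k$. A family $\mathcal A\subset\Omega_n$ is increasing if $x\in\mathcal A$, $x\le y$ imply $y\in\mathcal A$, and fully symmetric if it is invariant under all permutations of the $n$ coordinates. Write $\mathrm{Cov}(\mathcal A,\mathcal B)=\mu(\mathcal A\cap\mathcal B)-\mu(\mathcal A)\mu(\mathcal B)$, $I_k(\mathcal A)=2\mu(\{x\in\mathcal A: x\oplus e_k\notin\mathcal A\})$ and $\mathcal W_1(\mathcal B,\mathcal B)=\sum_{i=1}^n I_i(\mathcal B)^2$. For functions $f,g:\Omega_n\to\mathbb R$ write $\mathrm{Cov}(f,g)=\mathbb E[fg]-\mathbb E[f]\mathbb E[g]$ and $I_k(f)=\mathbb E[|f(x)-f(x\oplus e_k)|]$, with expectations under $\mu$; $f$ is increasing if $x\le y$ implies $f(x)\le f(y)$, and fully symmetric if it is invariant under all permutations of the coordinates. All quotients below whose numerator is an influence equal to $0$ are read as $0$. **Theorem.** (1) There are universal constants $c_1,c_2>0$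 such that for every $n$ and all increasing $\mathcal A,\mathcal B\subset\Omega_n$ with $\mathcal B$ fully symmetric, $$\mathrm{Cov}(\mathcal A,\mathcal B)\ \ge\ c_1\sum_{i=1}^n\frac{I_i(\mathcal A)}{\sqrt{\log\frac{e}{I_i(\mathcal A)}}}\cdot\frac{I_i(\mathcal B)}{\sqrt{\log\frac{e^2}{\mathcal W_1(\mathcal B,\mathcal B)}}}\ \ge\ c_2\,\frac{\mu(\mathcal B)(1-\mu(\mathcal B))}{\sqrt n}\sum_{i=1}^n\frac{I_i(\mathcal A)}{\sqrt{\log\frac{e}{I_i(\mathcal A)}}}.$$ (2) (General form for bounded functions.) There is a universal constant $c>0$ such that for every $n$ and all increasing $f,g:\Omega_n\to[-1,1]$ with $f$ fully symmetric, $$\mathrm{Cov}(f,g)\ \ge\ c\sum_{i=1}^n\frac{I_i(f)}{\sqrt{\log\frac{e^3}{n I_i(f)^2}}}\cdot\frac{I_i(g)}{\sqrt{\log\frac{e^2}{I_i(g)}}}.$$ -/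

import Mathlib

namespace DiscreteCube

/-- The discrete cube `{0,1}^n`, with its coordinatewise partial order (`false < true`). -/
abbrev Cube (n : ℕ) : Type := Fin n → Bool

/-- The point `x ⊕ e_k`, obtained from `x` by replacing `x_k` by `1 - x_k`. -/
def flip {n : ℕ} (k : Fin n) (x : Cube n) : Cube n := Function.update x k (!(x k))

/-! ### Families of points of the cube -/

/-- The uniform probability measure of a family. -/
noncomputable def mu {n : ℕ} (A : Finset (Cube n)) : ℝ := (A.card : ℝ) / 2 ^ n

/-- The covariance of two families, `μ(A ∩ B) - μ(A) μ(B)`. -/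
noncomputable def cov {n : ℕ} (A B : Finset (Cube n)) : ℝ := mu (A ∩ B) - mu A * mu B

/-- A family is increasing if it contains every point above one of its points. -/
def Increasing {n : ℕ} (A : Finset (Cube n)) : Prop :=
  ∀ x y : Cube n, x ∈ A → x ≤ y → y ∈ A

/-- A family is fully symmetric if it is invariant under all permutations of the coordinates. -/
def FullySymmetric {n : ℕ} (A : Finset (Cube n)) : Prop :=
  ∀ (σ : Equiv.Perm (Fin n)) (x : Cube n), x ∘ σ ∈ A ↔ x ∈ A

/-- The influence of the `k`-th variable on a family, `2 μ({x ∈ A | x ⊕ e_k ∉ A})`. -/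
noncomputable def influence {n : ℕ} (A : Finset (Cube n)) (k : Fin n) : ℝ :=
  2 * mu (A.filter fun x => flip k x ∉ A)

/-- `W₁(A, B) = ∑ i, I_i(A) I_i(B)`. -/
noncomputable def W1 {n : ℕ} (A B : Finset (Cube n)) : ℝ :=
  ∑ i, influence A i * influence B i

/-- `ψ(x) = x / √(log (e / x))`; in particular `ψ(0) = 0`. -/
noncomputable def psi (x : ℝ) : ℝ := x / √(Real.log (Real.exp 1 / x))

/-! ### Real functions on the cube -/

/-- The expectation of a function with respect to the uniform measure. -/
noncomputable def expect {n : ℕ} (f : Cube n → ℝ) : ℝ := (∑ x, f x) / 2 ^ n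

/-- The covariance of two functions, `E[fg] - E[f] E[g]`. -/
noncomputable def covFun {n : ℕ} (f g : Cube n → ℝ) : ℝ :=
  expect (fun x => f x * g x) - expect f * expect g

/-- The influence of the `k`-th variable on a function, `E[|f(x) - f(x ⊕ e_k)|]`. -/
noncomputable def influenceFun {n : ℕ} (f : Cube n → ℝ) (k : Fin n) : ℝ :=
  expect fun x => |f x - f (flip k x)|

/-- A function is fully symmetric if it is invariant under all permutations of the coordinates. -/
def FullySymmetricFun {n : ℕ} (f : Cube n → ℝ) : Prop :=
  ∀ (σ : Equiv.Perm (Fin n)) (x : Cube n), f (x ∘ σ) = f x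

end DiscreteCube

namespace DiscreteCube

open Finset

variable {n : ℕ}

/-! ### Expectations -/

/-! Covariance is read along a path of correlations. Let `x`, `y` be uniform points whose `j`-th
coordinates have correlation `ρ j`. Then `corr ρ f g` = E[f(x) g(y)] is affine in each `ρ k`, with
slope the same form applied to the `k`-th derivatives, hence nonnegative for increasing functions.
Cov(f, g) is the increase of `corr` from ρ = 0 to ρ = 1 (`corr_update`, `corr_mono`).

The model case is `clip`, the truncated normalized sum (`covFun_clip_ge`). Correlations are raised
from 0 to R_i ~ 1/√(log(e²/I_i(g))), smallest R_i first. When coordinate `a` is raised, all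
correlations are at most R_a, so by a Chernoff bound the conditional mean of the `a`-th derivative
of `clip` given `y` is of order 1/√n outside an event whose probability is small compared with
I_a(g). The slope is thus at least a constant times I_a(g)/√n, and the gain at least a constant
times R_a I_a(g)/√n.

A symmetric increasing family is, up to the factor min(μ, 1-μ)/2, at least as correlated with g as
any symmetric function bounded by 1 (`covFun_ind_ge`): after symmetrizing g, both covariances are
compared with one L¹ distance of g to a constant. Slicing f into families of the form {weight > t}
gives Cov(f, g) ≥ (V/2) Cov(clip, g), where V is the weighted sum of the quantities min(μ, 1-μ) of
the slices. A level-one inequality (`expect_ind_mul_normSum_le`) bounds V below by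
s/(8√(log(e³/s²))), where s = √n I_k(f). This is part (2) (`covFun_ge_of_symm`).

The first inequality of (1) is (2) for indicators, with W₁(B, B) = n I_k(B)² by symmetry and the
logarithms changed by bounded factors. The second holds term by term (`mu_mul_le_influenceFun`): B
is a half-space for the coordinate sum, and its level-one weight is bounded below through its
threshold and a reverse Chernoff bound (`exp_le_mu`). -/

theorem expect_add (f g : Cube n → ℝ) :
    expect (fun x => f x + g x) = expect f + expect g := by
  simp only [expect, sum_add_distrib, add_div]

theorem expect_sub (f g : Cube n → ℝ) :
    expect (fun x => f x - g x) = expect f - expect g := by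
  simp only [expect, sum_sub_distrib, sub_div]

theorem expect_neg (f : Cube n → ℝ) : expect (fun x => -f x) = -expect f := by
  simp only [expect, sum_neg_distrib, neg_div]

theorem expect_const_mul (c : ℝ) (f : Cube n → ℝ) :
    expect (fun x => c * f x) = c * expect f := by
  simp only [expect, ← mul_sum, mul_div_assoc]

theorem expect_mul_const (f : Cube n → ℝ) (c : ℝ) :
    expect (fun x => f x * c) = expect f * c := by
  simp only [mul_comm _ c, expect_const_mul]

theorem expect_const (c : ℝ) : expect (fun _ : Cube n => c) = c := by
  simp [expect]

theorem expect_sum {ι : Type*} (s : Finset ι) (f : ι → Cube n → ℝ) :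
    expect (fun x => ∑ i ∈ s, f i x) = ∑ i ∈ s, expect (f i) := by
  simp only [expect]
  rw [sum_comm, sum_div]

theorem expect_mono {f g : Cube n → ℝ} (h : ∀ x, f x ≤ g x) : expect f ≤ expect g := by
  unfold expect
  gcongr
  exact h _

theorem expect_nonneg {f : Cube n → ℝ} (h : ∀ x, 0 ≤ f x) : 0 ≤ expect f := by
  rw [← expect_const (n := n) 0]
  exact expect_mono h

theorem expect_comm (F : Cube n → Cube n → ℝ) :
    expect (fun x => expect fun y => F x y) = expect fun y => expect fun x => F x y := by
  simp only [expect, ← sum_div]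
  rw [sum_comm]

theorem expect_comp_equiv (e : Cube n ≃ Cube n) (f : Cube n → ℝ) :
    expect (fun x => f (e x)) = expect f := by
  unfold expect
  rw [e.sum_comp]

theorem flip_flip (k : Fin n) (x : Cube n) : flip k (flip k x) = x := by
  simp [flip]

theorem flip_apply_self (k : Fin n) (x : Cube n) : flip k x k = !x k := by
  simp [flip]

theorem flip_apply_of_ne {k j : Fin n} (h : j ≠ k) (x : Cube n) : flip k x j = x j := by
  simp [flip, h]

theorem expect_flip (k : Fin n) (f : Cube n → ℝ) :
    expect (fun x => f (flip k x)) = expect f :=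
  expect_comp_equiv (Function.Involutive.toPerm (flip k) (flip_flip k)) f

theorem expect_comp_perm (σ : Equiv.Perm (Fin n)) (f : Cube n → ℝ) :
    expect (fun x => f (x ∘ σ)) = expect f :=
  expect_comp_equiv (Equiv.arrowCongr σ.symm (Equiv.refl Bool)) f

theorem expect_prod (φ : Fin n → Bool → ℝ) :
    expect (fun x => ∏ j, φ j (x j)) = ∏ j, (φ j true + φ j false) / 2 := by
  have h := Finset.prod_univ_sum (fun _ : Fin n => (univ : Finset Bool)) φ
  rw [Fintype.piFinset_univ] at h
  unfold expect
  rw [← h, prod_div_distrib]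
  simp

/-! ### Signs and discrete derivatives -/

/-- The value `±1` of a coordinate. -/
noncomputable def sgn (b : Bool) : ℝ := if b then 1 else -1

@[simp] theorem sgn_true : sgn true = 1 := rfl

@[simp] theorem sgn_false : sgn false = -1 := by simp [sgn]

theorem sgn_not (b : Bool) : sgn (!b) = -sgn b := by cases b <;> simp

theorem sgn_mul_self (b : Bool) : sgn b * sgn b = 1 := by cases b <;> simp

/-- The discrete derivative `(f(x^{k→1}) - f(x^{k→0})) / 2`. -/
noncomputable def deriv (k : Fin n) (f : Cube n → ℝ) (x : Cube n) : ℝ :=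
  sgn (x k) * (f x - f (flip k x)) / 2

theorem flip_le {k : Fin n} {x : Cube n} (h : x k = true) : flip k x ≤ x := by
  intro j
  by_cases hj : j = k
  · subst hj; rw [h]; exact Bool.le_true _
  · rw [flip_apply_of_ne hj]

theorem le_flip {k : Fin n} {x : Cube n} (h : x k = false) : x ≤ flip k x := by
  intro j
  by_cases hj : j = k
  · subst hj; rw [h]; exact Bool.false_le _
  · rw [flip_apply_of_ne hj]

theorem deriv_eq_abs {f : Cube n → ℝ} (hf : Monotone f) (k : Fin n) (x : Cube n) :
    deriv k f x = |f x - f (flip k x)| / 2 := by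
  unfold deriv
  cases h : x k
  · rw [abs_of_nonpos (sub_nonpos.2 (hf (le_flip h)))]; simp
  · rw [abs_of_nonneg (sub_nonneg.2 (hf (flip_le h)))]; simp

theorem deriv_nonneg {f : Cube n → ℝ} (hf : Monotone f) (k : Fin n) (x : Cube n) :
    0 ≤ deriv k f x := by
  rw [deriv_eq_abs hf]; positivity

theorem influenceFun_eq {f : Cube n → ℝ} (hf : Monotone f) (k : Fin n) :
    influenceFun f k = 2 * expect (deriv k f) := by
  rw [← expect_const_mul]
  unfold influenceFun
  congr 1
  funext x
  rw [deriv_eq_abs hf]; ring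

theorem influenceFun_nonneg (f : Cube n → ℝ) (k : Fin n) : 0 ≤ influenceFun f k :=
  expect_nonneg fun _ => abs_nonneg _

theorem deriv_le_one {f : Cube n → ℝ} (h : ∀ x, f x ∈ Set.Icc (-1 : ℝ) 1) (k : Fin n)
    (x : Cube n) : deriv k f x ≤ 1 := by
  have h1 := h x
  have h2 := h (flip k x)
  rw [Set.mem_Icc] at h1 h2
  unfold deriv
  cases x k <;> simp <;> linarith

/-- Pairing `x` with `x ⊕ e_k` in an expectation. -/
theorem expect_mul_sgn_mul (k : Fin n) (f w : Cube n → ℝ) (hw : ∀ x, w (flip k x) = w x) :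
    expect (fun x => f x * sgn (x k) * w x) = expect fun x => deriv k f x * w x := by
  have h := expect_flip k fun x => f x * sgn (x k) * w x
  simp only [hw, flip_apply_self, sgn_not] at h
  have h2 : (fun x => deriv k f x * w x) = fun x =>
      (1 / 2) * (f x * sgn (x k) * w x + f (flip k x) * -sgn (x k) * w x) := by
    funext x; unfold deriv; ring
  rw [h2, expect_const_mul, expect_add, h]
  ring

/-! ### The correlated bilinear form -/

/-- The density of a pair of points whose `j`-th coordinates have correlation `ρ j`. -/
noncomputable def kernel (ρ : Fin n → ℝ) (x y : Cube n) : ℝ :=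
  ∏ j, (1 + ρ j * (sgn (x j) * sgn (y j)))

/-- `E[f(x) g(y)]` for a pair of points with correlations `ρ`. -/
noncomputable def corr (ρ : Fin n → ℝ) (f g : Cube n → ℝ) : ℝ :=
  expect fun x => expect fun y => f x * g y * kernel ρ x y

theorem kernel_nonneg {ρ : Fin n → ℝ} (h : ∀ j, ρ j ∈ Set.Icc (0 : ℝ) 1) (x y : Cube n) :
    0 ≤ kernel ρ x y := by
  refine prod_nonneg fun j _ => ?_
  have := h j
  rw [Set.mem_Icc] at this
  cases x j <;> cases y j <;> simp <;> linarith

theorem corr_nonneg {ρ : Fin n → ℝ} (h : ∀ j, ρ j ∈ Set.Icc (0 : ℝ) 1) {f g : Cube n → ℝ}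
    (hf : ∀ x, 0 ≤ f x) (hg : ∀ x, 0 ≤ g x) : 0 ≤ corr ρ f g :=
  expect_nonneg fun x => expect_nonneg fun y =>
    mul_nonneg (mul_nonneg (hf x) (hg y)) (kernel_nonneg h x y)

theorem corr_zero (f g : Cube n → ℝ) : corr 0 f g = expect f * expect g := by
  simp only [corr, kernel, Pi.zero_apply, zero_mul, add_zero, prod_const_one, mul_one,
    expect_const_mul, expect_mul_const]

theorem kernel_one (x y : Cube n) : kernel 1 x y = if x = y then 2 ^ n else 0 := by
  unfold kernel
  split_ifs with h
  · subst h
    simp only [sgn_mul_self, Pi.one_apply]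
    norm_num
  · obtain ⟨j, hj⟩ := Function.ne_iff.1 h
    refine prod_eq_zero (mem_univ j) ?_
    revert hj
    cases x j <;> cases y j <;> simp

theorem corr_one (f g : Cube n → ℝ) : corr 1 f g = expect fun x => f x * g x := by
  unfold corr
  congr 1
  funext x
  simp [kernel_one, expect]

theorem kernel_update (ρ : Fin n → ℝ) (k : Fin n) (b : ℝ) (x y : Cube n) :
    kernel (Function.update ρ k b) x y =
      (1 + b * (sgn (x k) * sgn (y k))) * kernel (Function.update ρ k 0) x y := by
  unfold kernel
  rw [← mul_prod_erase univ _ (mem_univ k), ← mul_prod_erase univ _ (mem_univ k)]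
  simp only [Function.update_self, zero_mul, add_zero, one_mul]
  congr 1
  refine prod_congr rfl fun j hj => ?_
  rw [Function.update_of_ne (ne_of_mem_erase hj), Function.update_of_ne (ne_of_mem_erase hj)]

theorem kernel_flip_left {ρ : Fin n → ℝ} {k : Fin n} (h : ρ k = 0) (x y : Cube n) :
    kernel ρ (flip k x) y = kernel ρ x y := by
  refine prod_congr rfl fun j _ => ?_
  by_cases hj : j = k
  · subst hj; simp [h]
  · rw [flip_apply_of_ne hj]

theorem kernel_comm (ρ : Fin n → ℝ) (x y : Cube n) : kernel ρ x y = kernel ρ y x :=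
  prod_congr rfl fun j _ => by rw [mul_comm (sgn (x j))]

/-- The kernel is affine in its `k`-th correlation, and the linear term carries the signs of x_k and
y_k times a factor independent of both. Pairing each point with its flip turns f·sgn and g·sgn into
derivatives. -/
theorem corr_update (ρ : Fin n → ℝ) (k : Fin n) (b : ℝ) (f g : Cube n → ℝ) :
    corr (Function.update ρ k b) f g = corr (Function.update ρ k 0) f g +
      b * corr (Function.update ρ k 0) (deriv k f) (deriv k g) := by
  have h0 : Function.update ρ k 0 k = 0 := Function.update_self ..
  have key : corr (Function.update ρ k 0) (deriv k f) (deriv k g) =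
      expect fun x => expect fun y =>
        f x * g y * (sgn (x k) * sgn (y k)) * kernel (Function.update ρ k 0) x y := by
    unfold corr
    have e1 : ∀ x, (expect fun y => deriv k f x * deriv k g y *
        kernel (Function.update ρ k 0) x y) =
        deriv k f x * expect fun y => g y * sgn (y k) * kernel (Function.update ρ k 0) x y := by
      intro x
      rw [expect_mul_sgn_mul k g _ fun y => by
        rw [kernel_comm, kernel_flip_left h0, kernel_comm], ← expect_const_mul]
      simp only [mul_assoc]
    simp only [e1]
    rw [← expect_mul_sgn_mul k f _ fun x => by simp only [kernel_flip_left h0]]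
    congr 1
    funext x
    rw [← expect_const_mul]
    congr 1
    funext y
    ring
  rw [key, ← expect_const_mul]
  unfold corr
  rw [← expect_add]
  congr 1
  funext x
  rw [← expect_const_mul, ← expect_add]
  congr 1
  funext y
  rw [kernel_update]
  ring

/-- Correlations are raised to 1 one at a time; each slope is nonnegative because both derivatives
and the kernel are. The case ρ = 0 is Harris' inequality. -/
theorem corr_mono {f g : Cube n → ℝ} (hf : Monotone f) (hg : Monotone g) {ρ : Fin n → ℝ}
    (h : ∀ j, ρ j ∈ Set.Icc (0 : ℝ) 1) : corr ρ f g ≤ corr 1 f g := by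
  classical
  suffices H : ∀ s : Finset (Fin n), corr ρ f g ≤ corr (fun j => if j ∈ s then 1 else ρ j) f g by
    have := H univ
    simp only [mem_univ, if_true] at this
    exact this
  intro s
  induction s using Finset.induction_on with
  | empty => simp
  | insert a s ha ih =>
    refine ih.trans ?_
    set τ : Fin n → ℝ := fun j => if j ∈ s then 1 else ρ j with hτ
    have e1 : (fun j => if j ∈ insert a s then 1 else ρ j) = Function.update τ a 1 := by
      funext j
      by_cases hj : j = a
      · subst hj; simp
      · simp [hj, hτ]
    have e2 : τ = Function.update τ a (ρ a) := by
      funext j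
      by_cases hj : j = a
      · subst hj; simp [hτ, ha]
      · simp [hj]
    rw [e1, corr_update τ a 1]
    conv_lhs => rw [e2, corr_update τ a]
    have h1 : 0 ≤ corr (Function.update τ a 0) (deriv a f) (deriv a g) := by
      refine corr_nonneg (fun j => ?_) (deriv_nonneg hf a) (deriv_nonneg hg a)
      by_cases hj : j = a
      · subst hj; simp
      · simp only [Function.update_of_ne hj, hτ]
        split_ifs
        · simp
        · exact h j
    have := (h a).2
    gcongr

/-! ### Linear forms and their moments -/

/-- The sum of the coordinates `±1`. -/
noncomputable def signSum (x : Cube n) : ℝ := ∑ j, sgn (x j)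

theorem expect_kernel (ρ : Fin n → ℝ) (y : Cube n) : expect (fun x => kernel ρ x y) = 1 := by
  unfold kernel
  rw [expect_prod fun j b => 1 + ρ j * (sgn b * sgn (y j))]
  refine prod_eq_one fun j _ => ?_
  simp only [sgn_true, sgn_false]
  ring

theorem expect_sgn_mul_sgn_mul_kernel (ρ : Fin n → ℝ) (y : Cube n) {j k : Fin n} (h : j ≠ k) :
    expect (fun x => sgn (x j) * sgn (x k) * kernel ρ x y) =
      (ρ j * sgn (y j)) * (ρ k * sgn (y k)) := by
  have e : (fun x : Cube n => sgn (x j) * sgn (x k) * kernel ρ x y) = fun x =>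
      ∏ l, (if l = j then sgn (x l) else 1) * (if l = k then sgn (x l) else 1) *
        (1 + ρ l * (sgn (x l) * sgn (y l))) := by
    funext x
    rw [prod_mul_distrib, prod_mul_distrib]
    simp [kernel]
  rw [e, expect_prod fun l b => (if l = j then sgn b else 1) * (if l = k then sgn b else 1) *
        (1 + ρ l * (sgn b * sgn (y l)))]
  have e2 : ∀ l, (((if l = j then sgn true else 1) * (if l = k then sgn true else 1) *
        (1 + ρ l * (sgn true * sgn (y l)))) + ((if l = j then sgn false else 1) *
        (if l = k then sgn false else 1) * (1 + ρ l * (sgn false * sgn (y l))))) / 2 =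
      (if l = j then ρ l * sgn (y l) else 1) * (if l = k then ρ l * sgn (y l) else 1) := by
    intro l
    by_cases h1 : l = j
    · have h2 : l ≠ k := fun h3 => h (h1.symm.trans h3)
      simp [h1, h]; ring
    · by_cases h2 : l = k
      · simp [h2, h.symm]; ring
      · simp [h1, h2]; ring
  simp only [e2, prod_mul_distrib]
  simp

theorem expect_sq_signSum_mul_kernel_le (ρ : Fin n → ℝ) (y : Cube n) :
    expect (fun x => signSum x ^ 2 * kernel ρ x y) ≤ n + (∑ j, ρ j * sgn (y j)) ^ 2 := by
  have e : (fun x : Cube n => signSum x ^ 2 * kernel ρ x y) = fun x =>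
      ∑ j, ∑ k, sgn (x j) * sgn (x k) * kernel ρ x y := by
    funext x
    rw [signSum, sq, sum_mul_sum, sum_mul]
    simp only [sum_mul]
  rw [e, expect_sum, sq, sum_mul_sum]
  have hn : (n : ℝ) = ∑ j : Fin n, ∑ k, if j = k then (1 : ℝ) else 0 := by simp
  rw [hn, ← sum_add_distrib]
  refine sum_le_sum fun j _ => ?_
  rw [expect_sum, ← sum_add_distrib]
  refine sum_le_sum fun k _ => ?_
  by_cases h : j = k
  · subst h
    simp only [sgn_mul_self, one_mul, expect_kernel, if_true]
    nlinarith [mul_self_nonneg (ρ j * sgn (y j))]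
  · rw [expect_sgn_mul_sgn_mul_kernel ρ y h, if_neg h, zero_add]

theorem expect_exp_sum (c : Fin n → ℝ) :
    expect (fun x => Real.exp (∑ j, c j * sgn (x j))) = ∏ j, Real.cosh (c j) := by
  simp only [Real.exp_sum]
  rw [expect_prod fun j b => Real.exp (c j * sgn b)]
  simp [Real.cosh_eq]

theorem expect_exp_sum_le (c : Fin n → ℝ) :
    expect (fun x => Real.exp (∑ j, c j * sgn (x j))) ≤ Real.exp ((∑ j, c j ^ 2) / 2) := by
  rw [expect_exp_sum, sum_div, Real.exp_sum]
  exact prod_le_prod (fun j _ => (Real.cosh_pos _).le) fun j _ => Real.cosh_le_exp_half_sq _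

theorem expect_sq_signSum : expect (fun x : Cube n => signSum x ^ 2) ≤ n := by
  have := expect_sq_signSum_mul_kernel_le (0 : Fin n → ℝ) (fun _ => true)
  simpa [kernel] using this

/-! ### A truncated linear function -/

theorem sgn_mono {a b : Bool} (h : a ≤ b) : sgn a ≤ sgn b := by
  revert h
  cases a <;> cases b <;> simp

theorem signSum_mono : Monotone (signSum : Cube n → ℝ) :=
  fun _ _ h => sum_le_sum fun j _ => sgn_mono (h j)

theorem signSum_flip (k : Fin n) (x : Cube n) :
    signSum (flip k x) = signSum x - 2 * sgn (x k) := by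
  have h : ∀ j, sgn (flip k x j) = sgn (x j) - if j = k then 2 * sgn (x k) else 0 := by
    intro j
    by_cases hj : j = k
    · subst hj; rw [flip_apply_self, sgn_not, if_pos rfl]; ring
    · rw [flip_apply_of_ne hj, if_neg hj, sub_zero]
  simp [signSum, h, sum_sub_distrib]

theorem signSum_comp_perm (σ : Equiv.Perm (Fin n)) (x : Cube n) :
    signSum (x ∘ σ) = signSum x :=
  Equiv.sum_comp σ fun j => sgn (x j)

/-- The normalized sum of the coordinates, truncated to `[-1, 1]`. -/
noncomputable def clip (x : Cube n) : ℝ := max (-1) (min 1 (signSum x / (4 * √n)))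

theorem clip_mono : Monotone (clip : Cube n → ℝ) := by
  intro x y h
  unfold clip
  have := signSum_mono h
  gcongr

theorem clip_mem (x : Cube n) : clip x ∈ Set.Icc (-1 : ℝ) 1 :=
  ⟨le_max_left _ _, max_le (by norm_num) (min_le_left _ _)⟩

theorem clip_comp_perm (σ : Equiv.Perm (Fin n)) (x : Cube n) : clip (x ∘ σ) = clip x := by
  simp only [clip, signSum_comp_perm]

theorem clip_eq (hn : 0 < n) {x : Cube n} (h : |signSum x| ≤ 4 * √n) :
    clip x = signSum x / (4 * √n) := by
  have hs : 0 < 4 * √(n : ℝ) := by positivity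
  rw [abs_le] at h
  unfold clip
  rw [min_eq_right ((div_le_one hs).2 h.2), max_eq_right]
  rw [le_div_iff₀ hs]; linarith

/-- When |S| ≤ 2√n, a flip moves S by 2 and stays in the linear range |S| ≤ 4√n; otherwise the left
side is nonpositive. A quadratic minorant is used because only the conditional second moment of S is
then needed. -/
theorem deriv_clip_ge (hn : 0 < n) (k : Fin n) (x : Cube n) :
    1 / (4 * √n) * (1 - signSum x ^ 2 / (4 * n)) ≤ deriv k clip x := by
  have hn' : (0 : ℝ) < n := by exact_mod_cast hn
  have hs : 0 < √(n : ℝ) := by positivity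
  have hs1 : 1 ≤ √(n : ℝ) := Real.one_le_sqrt.2 (by exact_mod_cast hn)
  have hsq : √(n : ℝ) ^ 2 = n := Real.sq_sqrt hn'.le
  by_cases h : signSum x ^ 2 ≤ 4 * n
  · have h1 : |signSum x| ≤ 2 * √n := abs_le_of_sq_le_sq (by nlinarith) (by positivity)
    have h2 : |signSum (flip k x)| ≤ 4 * √n := by
      rw [signSum_flip]
      have : |2 * sgn (x k)| = 2 := by cases x k <;> simp
      have := abs_sub (signSum x) (2 * sgn (x k))
      linarith
    have : deriv k clip x = 1 / (4 * √n) := by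
      unfold deriv
      rw [clip_eq hn h2, clip_eq hn (by linarith), signSum_flip]
      have := sgn_mul_self (x k)
      field_simp
      linear_combination 2 * this
    rw [this]
    refine mul_le_of_le_one_right (by positivity) ?_
    have : 0 ≤ signSum x ^ 2 / (4 * n) := by positivity
    linarith
  · refine le_trans ?_ (deriv_nonneg clip_mono k x)
    refine mul_nonpos_of_nonneg_of_nonpos (by positivity) ?_
    rw [sub_nonpos, one_le_div (by positivity)]
    linarith

/-- If all correlations are at most `r`, then only the points where the linear form
`∑ ρ j y_j` exceeds `√n` can prevent the smoothed derivative of `clip` from being large. -/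
theorem expect_deriv_clip_mul_kernel_ge (hn : 0 < n) (k : Fin n) {ρ : Fin n → ℝ}
    (hρ : ∀ j, ρ j ∈ Set.Icc (0 : ℝ) 1) {t : ℝ} (ht : 0 ≤ t) (y : Cube n) :
    1 / (8 * √n) * (1 - Real.exp (t * (∑ j, ρ j * sgn (y j)) - t * √n) -
        Real.exp (t * -(∑ j, ρ j * sgn (y j)) - t * √n)) ≤
      expect fun x => deriv k clip x * kernel ρ x y := by
  have hn' : (0 : ℝ) < n := by exact_mod_cast hn
  have hs : 0 < √(n : ℝ) := by positivity
  have hsq : √(n : ℝ) ^ 2 = n := Real.sq_sqrt hn'.le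
  set Y := ∑ j, ρ j * sgn (y j) with hY
  by_cases h : |Y| ≤ √n
  · have h1 : 1 / (4 * √n) * (1 - (n + Y ^ 2) / (4 * n)) ≤
        expect fun x => deriv k clip x * kernel ρ x y := by
      have h2 : expect (fun x : Cube n =>
          1 / (4 * √n) * (1 - signSum x ^ 2 / (4 * n)) * kernel ρ x y) ≤
          expect fun x => deriv k clip x * kernel ρ x y :=
        expect_mono fun x =>
          mul_le_mul_of_nonneg_right (deriv_clip_ge hn k x) (kernel_nonneg hρ x y)
      refine le_trans ?_ h2
      have e : (fun x : Cube n => 1 / (4 * √n) * (1 - signSum x ^ 2 / (4 * n)) * kernel ρ x y) =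
          fun x => 1 / (4 * √n) *
            (kernel ρ x y - 1 / (4 * n) * (signSum x ^ 2 * kernel ρ x y)) := by
        funext x; ring
      rw [e, expect_const_mul, expect_sub, expect_const_mul, expect_kernel]
      have := expect_sq_signSum_mul_kernel_le ρ y
      rw [div_eq_mul_one_div (_ + _), mul_comm (_ + _)]
      gcongr
    refine le_trans ?_ h1
    have hY2 : Y ^ 2 ≤ n := by rw [← hsq]; exact sq_le_sq' (abs_le.1 h).1 (abs_le.1 h).2
    have h3 : (n + Y ^ 2) / (4 * n) ≤ 1 / 2 := by
      rw [div_le_div_iff₀ (by positivity) (by norm_num)]; linarith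
    calc _ ≤ 1 / (8 * √n) * 1 := by
          gcongr
          have := Real.exp_pos (t * Y - t * √n)
          have := Real.exp_pos (t * -Y - t * √n)
          linarith
      _ = 1 / (4 * √n) * (1 - 1 / 2) := by field_simp; norm_num
      _ ≤ _ := by gcongr
  -- Here |Y| > √n, so one of the two exponentials is at least 1 and the lower bound is nonpositive.
  · refine le_trans ?_ (expect_nonneg fun x =>
      mul_nonneg (deriv_nonneg clip_mono k x) (kernel_nonneg hρ x y))
    refine mul_nonpos_of_nonneg_of_nonpos (by positivity) ?_
    have h1 := Real.exp_pos (t * Y - t * √n)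
    have h2 := Real.exp_pos (t * -Y - t * √n)
    rw [not_le, lt_abs] at h
    rcases h with h | h
    · have : 1 ≤ Real.exp (t * Y - t * √n) := Real.one_le_exp (by nlinarith)
      linarith
    · have : 1 ≤ Real.exp (t * -Y - t * √n) := Real.one_le_exp (by nlinarith)
      linarith

/-- The previous pointwise bound is averaged against the derivative of g, which lies in [0, 1]. Each
exponential error is a Chernoff bound for a linear form with coefficients at most r at level √n. -/
theorem corr_deriv_clip_ge (hn : 0 < n) {g : Cube n → ℝ} (hg : Monotone g)
    (hg1 : ∀ x, g x ∈ Set.Icc (-1 : ℝ) 1) (k : Fin n) {ρ : Fin n → ℝ} {r : ℝ} (hr : 0 < r)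
    (hr1 : r ≤ 1) (hρ : ∀ j, ρ j ∈ Set.Icc (0 : ℝ) r) :
    1 / (8 * √n) * (expect (deriv k g) - 2 * Real.exp (-(1 / (2 * r ^ 2)))) ≤
      corr ρ (deriv k clip) (deriv k g) := by
  have hn' : (0 : ℝ) < n := by exact_mod_cast hn
  have hs : 0 < √(n : ℝ) := by positivity
  have hsq : √(n : ℝ) ^ 2 = n := Real.sq_sqrt hn'.le
  have hρ1 : ∀ j, ρ j ∈ Set.Icc (0 : ℝ) 1 := fun j => ⟨(hρ j).1, (hρ j).2.trans hr1⟩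
  -- The minimizer of the Chernoff exponent n t² r²/2 - t√n, with minimum -1/(2r²).
  set t : ℝ := 1 / (√n * r ^ 2) with ht
  have ht0 : 0 ≤ t := by positivity
  have e : corr ρ (deriv k clip) (deriv k g) =
      expect fun y => deriv k g y * expect fun x => deriv k clip x * kernel ρ x y := by
    unfold corr
    rw [expect_comm]
    congr 1
    funext y
    rw [← expect_const_mul]
    congr 1
    funext x
    ring
  have tail : ∀ ε : ℝ, ε ^ 2 = 1 →
      expect (fun y : Cube n => Real.exp (t * (ε * ∑ j, ρ j * sgn (y j)) - t * √n)) ≤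
        Real.exp (-(1 / (2 * r ^ 2))) := by
    intro ε hε
    have e1 : (fun y : Cube n => Real.exp (t * (ε * ∑ j, ρ j * sgn (y j)) - t * √n)) =
        fun y => Real.exp (∑ j, (t * ε * ρ j) * sgn (y j)) * Real.exp (-(t * √n)) := by
      funext y
      rw [← Real.exp_add, sub_eq_add_neg, mul_sum, mul_sum]
      simp only [mul_assoc]
    rw [e1, expect_mul_const]
    refine (mul_le_mul_of_nonneg_right (expect_exp_sum_le _) (Real.exp_pos _).le).trans ?_
    rw [← Real.exp_add, Real.exp_le_exp]
    have h1 : ∑ j, (t * ε * ρ j) ^ 2 ≤ ∑ _j : Fin n, t ^ 2 * r ^ 2 := by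
      refine sum_le_sum fun j _ => ?_
      rw [mul_pow, mul_pow, hε, mul_one]
      have := (hρ j).1
      have := (hρ j).2
      gcongr
    rw [sum_const, card_univ, Fintype.card_fin, nsmul_eq_mul] at h1
    have h2 : (n : ℝ) * (t ^ 2 * r ^ 2) = 1 / r ^ 2 := by
      rw [ht, div_pow, mul_pow, hsq]; field_simp
    have h3 : t * √n = 1 / r ^ 2 := by rw [ht]; field_simp
    rw [h2] at h1
    rw [h3]
    have h4 : 1 / (2 * r ^ 2) = (1 / r ^ 2) / 2 := by field_simp
    rw [h4]
    linarith
  have hd0 := deriv_nonneg hg k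
  have hd1 := deriv_le_one hg1 k
  rw [e]
  calc _ ≤ expect fun y => 1 / (8 * √n) * (deriv k g y -
        Real.exp (t * (1 * ∑ j, ρ j * sgn (y j)) - t * √n) -
        Real.exp (t * (-1 * ∑ j, ρ j * sgn (y j)) - t * √n)) := by
        rw [expect_const_mul, expect_sub, expect_sub]
        have h1 := tail 1 (by norm_num)
        have h2 := tail (-1) (by norm_num)
        exact mul_le_mul_of_nonneg_left (by linarith) (by positivity)
    _ ≤ _ := by
        refine expect_mono fun y => ?_
        refine le_trans ?_ (mul_le_mul_of_nonneg_left
          (expect_deriv_clip_mul_kernel_ge hn k hρ1 ht0 y) (hd0 y))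
        rw [one_mul, neg_one_mul, mul_left_comm]
        have h1 := Real.exp_pos (t * (∑ j, ρ j * sgn (y j)) - t * √n)
        have h2 := Real.exp_pos (t * -(∑ j, ρ j * sgn (y j)) - t * √n)
        have := hd0 y
        have := hd1 y
        gcongr
        nlinarith

theorem influenceFun_le_two {g : Cube n → ℝ} (hg1 : ∀ x, g x ∈ Set.Icc (-1 : ℝ) 1)
    (k : Fin n) : influenceFun g k ≤ 2 := by
  rw [← expect_const (n := n) 2]
  refine expect_mono fun x => ?_
  have h1 := hg1 x
  have h2 := hg1 (flip k x)
  rw [Set.mem_Icc] at h1 h2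
  rw [abs_le]
  constructor <;> linarith

theorem covFun_eq_corr (f g : Cube n → ℝ) : covFun f g = corr 1 f g - corr 0 f g := by
  rw [corr_one, corr_zero, covFun]

theorem one_le_log_div {I : ℝ} (h0 : 0 < I) (h2 : I ≤ 2) :
    1 ≤ Real.log (Real.exp 1 ^ 2 / I) := by
  have := Real.exp_one_gt_d9
  rw [Real.le_log_iff_exp_le (by positivity), le_div_iff₀ h0]
  nlinarith

/-- The covariance of an increasing function with a truncated linear function. -/
theorem covFun_clip_ge (hn : 0 < n) {g : Cube n → ℝ} (hg : Monotone g)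
    (hg1 : ∀ x, g x ∈ Set.Icc (-1 : ℝ) 1) :
    1 / (64 * √n) * ∑ i, influenceFun g i / √(Real.log (Real.exp 1 ^ 2 / influenceFun g i)) ≤
      covFun clip g := by
  classical
  have hn' : (0 : ℝ) < n := by exact_mod_cast hn
  have hs : 0 < √(n : ℝ) := by positivity
  set L : Fin n → ℝ := fun i => Real.log (Real.exp 1 ^ 2 / influenceFun g i) with hL
  set R : Fin n → ℝ := fun i => 1 / (2 * √(L i)) with hR
  have hI2 := influenceFun_le_two hg1
  have hR0 : ∀ i, 0 ≤ R i := fun i => by positivity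
  have hL1 : ∀ i, 0 < influenceFun g i → 1 ≤ L i := fun i hi => one_le_log_div hi (hI2 i)
  have hR1 : ∀ i, R i ≤ 1 := by
    intro i
    rcases (influenceFun_nonneg g i).eq_or_lt with hi | hi
    -- For zero influence the conventions for division and logarithm at 0 give L = 0 and R = 0.
    · simp [hR, hL, ← hi]
    · have := Real.one_le_sqrt.2 (hL1 i hi)
      simp only [hR]
      rw [div_le_one (by positivity)]
      linarith
  have main : ∀ s : Finset (Fin n),
      corr 0 clip g + ∑ i ∈ s, 1 / (64 * √n) * (influenceFun g i / √(L i)) ≤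
        corr (fun j => if j ∈ s then R j else 0) clip g := by
    intro s
    -- Inserting indices in increasing order of R ensures that all correlations already present are
    -- at most R a.
    induction s using Finset.induction_on_max_value R with
    | empty => simp; exact le_rfl
    | insert a s ha hmax ih =>
      set τ : Fin n → ℝ := fun j => if j ∈ s then R j else 0 with hτ
      have hτR : ∀ j, τ j ∈ Set.Icc 0 (R a) := by
        intro j
        simp only [hτ]
        split_ifs with h
        · exact ⟨hR0 j, hmax j h⟩
        · exact ⟨le_rfl, hR0 a⟩
      have e1 : (fun j => if j ∈ insert a s then R j else 0) = Function.update τ a (R a) := by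
        funext j
        by_cases hj : j = a
        · subst hj; simp
        · simp [hj, hτ]
      have e2 : Function.update τ a 0 = τ := by
        funext j
        by_cases hj : j = a
        · subst hj; simp [hτ, ha]
        · simp [hj]
      rw [e1, corr_update, e2, sum_insert ha]
      suffices H : 1 / (64 * √n) * (influenceFun g a / √(L a)) ≤
          R a * corr τ (deriv a clip) (deriv a g) by linarith
      rcases (influenceFun_nonneg g a).eq_or_lt with hi | hi
      · rw [← hi, zero_div, mul_zero]
        exact mul_nonneg (hR0 a) (corr_nonneg (fun j => ⟨(hτR j).1, (hτR j).2.trans (hR1 a)⟩)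
          (deriv_nonneg clip_mono a) (deriv_nonneg hg a))
      · have hLa := hL1 a hi
        have hsL : 0 < √(L a) := Real.sqrt_pos.2 (by linarith)
        have hRa : 0 < R a := by simp only [hR]; positivity
        have h1 := corr_deriv_clip_ge hn hg hg1 a hRa (hR1 a) hτR
        have h2 : 1 / (2 * R a ^ 2) = L a + L a := by
          simp only [hR]
          rw [div_pow, mul_pow, Real.sq_sqrt (by linarith)]
          field_simp
          norm_num
        have h3 : Real.exp (-(1 / (2 * R a ^ 2))) =
            (influenceFun g a / Real.exp 1 ^ 2) * (influenceFun g a / Real.exp 1 ^ 2) := by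
          rw [h2, neg_add, Real.exp_add, Real.exp_neg, Real.exp_log (by positivity), inv_div]
        -- The choice of R makes the tail (I/e²)², quadratic in I. With I ≤ 2 and e⁴ ≥ 16 the two
        -- tails cost at most half of the mean derivative I/2.
        have h4 : Real.exp (-(1 / (2 * R a ^ 2))) ≤ influenceFun g a / 8 := by
          rw [h3, div_mul_div_comm, div_le_div_iff₀ (by positivity) (by norm_num)]
          have h5 : 4 ≤ Real.exp 1 ^ 2 := by nlinarith [Real.exp_one_gt_d9]
          have h6 : 16 ≤ Real.exp 1 ^ 2 * Real.exp 1 ^ 2 := by nlinarith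
          have := hI2 a
          nlinarith
        have h5 : expect (deriv a g) = influenceFun g a / 2 := by
          rw [influenceFun_eq hg]; ring
        calc 1 / (64 * √n) * (influenceFun g a / √(L a))
            = R a * (1 / (8 * √n) * (influenceFun g a / 4)) := by
              simp only [hR]; field_simp; norm_num
          _ ≤ R a * (1 / (8 * √n) *
                (expect (deriv a g) - 2 * Real.exp (-(1 / (2 * R a ^ 2))))) := by
              gcongr
              linarith
          _ ≤ _ := by gcongr
  have h1 := main univ
  simp only [mem_univ, if_true] at h1
  have h2 := corr_mono (n := n) clip_mono hg (ρ := R) fun j => ⟨hR0 j, hR1 j⟩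
  rw [covFun_eq_corr, mul_sum]
  exact le_sub_iff_add_le'.2 (h1.trans h2)

/-! ### Symmetrization -/

/-- The number of coordinates equal to `1`. -/
def weight (x : Cube n) : ℕ := #{i | x i = true}

theorem weight_le (x : Cube n) : weight x ≤ n :=
  (card_filter_le _ _).trans_eq (by simp)

/-- A bijection from a subset of the ones of x onto the ones of y extends to a permutation. Hence
symmetric increasing functions are monotone in the weight. -/
theorem exists_perm_le {x y : Cube n} (h : weight y ≤ weight x) :
    ∃ σ : Equiv.Perm (Fin n), y ∘ σ ≤ x := by
  obtain ⟨T, hT, hc⟩ := exists_subset_card_eq h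
  have e : {i // i ∈ T} ≃ {i // y i = true} := by
    refine Fintype.equivOfCardEq ?_
    rw [Fintype.card_coe, hc, Fintype.card_subtype, weight]
  refine ⟨e.extendSubtype, fun i => ?_⟩
  by_cases hi : i ∈ T
  · have := hT hi
    rw [mem_filter] at this
    rw [this.2]
    exact Bool.le_true _
  · have := Equiv.extendSubtype_not_mem e i hi
    rw [Bool.not_eq_true] at this
    rw [Function.comp_apply, this]
    exact Bool.false_le _

theorem le_of_weight_le {f : Cube n → ℝ} (hf : Monotone f) (hs : FullySymmetricFun f)
    {x y : Cube n} (h : weight y ≤ weight x) : f y ≤ f x := by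
  obtain ⟨σ, hσ⟩ := exists_perm_le h
  rw [← hs σ y]
  exact hf hσ

/-- The average of a function over all permutations of the coordinates. -/
noncomputable def symmetrize (g : Cube n → ℝ) (x : Cube n) : ℝ :=
  (∑ σ : Equiv.Perm (Fin n), g (x ∘ σ)) / Fintype.card (Equiv.Perm (Fin n))

theorem symmetrize_mono {g : Cube n → ℝ} (hg : Monotone g) : Monotone (symmetrize g) := by
  intro x y h
  unfold symmetrize
  gcongr with σ
  exact hg fun i => h (σ i)

theorem symmetrize_symm (g : Cube n → ℝ) : FullySymmetricFun (symmetrize g) := by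
  intro τ x
  unfold symmetrize
  congr 1
  exact Equiv.sum_comp (Equiv.mulLeft τ) fun σ : Equiv.Perm (Fin n) => g (x ∘ σ)

theorem expect_mul_symmetrize {f : Cube n → ℝ} (hf : FullySymmetricFun f) (g : Cube n → ℝ) :
    expect (fun x => f x * symmetrize g x) = expect fun x => f x * g x := by
  have e : (fun x => f x * symmetrize g x) = fun x =>
      (∑ σ : Equiv.Perm (Fin n), f (x ∘ σ) * g (x ∘ σ)) *
        (Fintype.card (Equiv.Perm (Fin n)) : ℝ)⁻¹ := by
    funext x
    simp only [hf _ x, ← mul_sum, symmetrize]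
    ring
  rw [e, expect_mul_const, expect_sum]
  simp only [expect_comp_perm _ fun x => f x * g x]
  rw [sum_const, card_univ, nsmul_eq_mul]
  have : (Fintype.card (Equiv.Perm (Fin n)) : ℝ) ≠ 0 := by
    exact_mod_cast Fintype.card_ne_zero
  field_simp

theorem covFun_symmetrize {f : Cube n → ℝ} (hf : FullySymmetricFun f) (g : Cube n → ℝ) :
    covFun f (symmetrize g) = covFun f g := by
  have h := expect_mul_symmetrize (f := fun _ : Cube n => (1 : ℝ)) (fun _ _ => rfl) g
  simp only [one_mul] at h
  rw [covFun, covFun, expect_mul_symmetrize hf, h]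

theorem covFun_eq_expect (f g : Cube n → ℝ) (α : ℝ) :
    covFun f g = expect fun x => (f x - expect f) * (g x - α) := by
  have e : (fun x => (f x - expect f) * (g x - α)) = fun x =>
      (f x * g x - expect f * g x) - (α * f x - α * expect f) := by
    funext x; ring
  rw [e, expect_sub, expect_sub, expect_sub, expect_const_mul, expect_const_mul, expect_const,
    covFun]
  ring

theorem expect_mem {f : Cube n → ℝ} {a b : ℝ} (h : ∀ x, f x ∈ Set.Icc a b) :
    expect f ∈ Set.Icc a b := by
  constructor
  · rw [← expect_const (n := n) a]; exact expect_mono fun x => (h x).1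
  · rw [← expect_const (n := n) b]; exact expect_mono fun x => (h x).2

/-! ### Families as functions -/

/-- The indicator function of a family. -/
noncomputable def ind (B : Finset (Cube n)) (x : Cube n) : ℝ := if x ∈ B then 1 else 0

theorem ind_mem (B : Finset (Cube n)) (x : Cube n) : ind B x ∈ Set.Icc (0 : ℝ) 1 := by
  unfold ind; split_ifs <;> simp

theorem expect_ind (B : Finset (Cube n)) : expect (ind B) = mu B := by
  simp [expect, ind, mu]

theorem mu_mem (B : Finset (Cube n)) : mu B ∈ Set.Icc (0 : ℝ) 1 := by
  rw [← expect_ind]; exact expect_mem (ind_mem B)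

theorem ind_mono {B : Finset (Cube n)} (h : Increasing B) : Monotone (ind B) := by
  intro x y hxy
  unfold ind
  by_cases hx : x ∈ B
  · rw [if_pos hx, if_pos (h x y hx hxy)]
  · rw [if_neg hx]; split_ifs <;> simp

theorem ind_symm {B : Finset (Cube n)} (h : FullySymmetric B) : FullySymmetricFun (ind B) := by
  intro σ x
  simp only [ind, h σ x]

theorem weight_lt_of_mem_of_notMem {B : Finset (Cube n)} (hB : Increasing B)
    (hs : FullySymmetric B) {x y : Cube n} (hx : x ∈ B) (hy : y ∉ B) : weight y < weight x := by
  by_contra! h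
  obtain ⟨σ, hσ⟩ := exists_perm_le h
  exact hy (hB _ _ ((hs σ x).2 hx) hσ)

/-- The smaller of the measures of a family and of its complement. -/
noncomputable def minMu (B : Finset (Cube n)) : ℝ := min (mu B) (1 - mu B)

theorem minMu_nonneg (B : Finset (Cube n)) : 0 ≤ minMu B :=
  le_min (mu_mem B).1 (sub_nonneg.2 (mu_mem B).2)

/-- Up to a factor, a symmetric increasing family has the least covariance with an increasing
function among all symmetric bounded functions. -/
theorem covFun_ind_ge {B : Finset (Cube n)} (hB : Increasing B) (hs : FullySymmetric B)
    {f g : Cube n → ℝ} (hf : ∀ x, f x ∈ Set.Icc (-1 : ℝ) 1) (hfs : FullySymmetricFun f)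
    (hg : Monotone g) : minMu B / 2 * covFun f g ≤ covFun (ind B) g := by
  rw [← covFun_symmetrize hfs g, ← covFun_symmetrize (ind_symm hs) g]
  set a := symmetrize g with ha
  have ham : ∀ {x y : Cube n}, weight y ≤ weight x → a y ≤ a x :=
    le_of_weight_le (symmetrize_mono hg) (symmetrize_symm g)
  -- Since α separates the values of a on B from those off B, (1_B - μ)(a - α) is pointwise
  -- nonnegative, hence at least minMu·|a - α|; the covariance with f is at most 2 E|a - α|.
  obtain ⟨α, h1, h2⟩ : ∃ α, (∀ x ∈ B, α ≤ a x) ∧ ∀ x, x ∉ B → a x ≤ α := by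
    rcases B.eq_empty_or_nonempty with h | h
    · refine ⟨a fun _ => true, by simp [h], fun x _ => symmetrize_mono hg fun i => Bool.le_true _⟩
    · obtain ⟨z, hz, hmin⟩ := exists_min_image B a h
      exact ⟨a z, hmin, fun x hx => ham (weight_lt_of_mem_of_notMem hB hs hz hx).le⟩
  have hE := expect_mem hf
  have hm := minMu_nonneg B
  have e1 : covFun f a ≤ 2 * expect fun x => |a x - α| := by
    rw [covFun_eq_expect f a α, ← expect_const_mul]
    refine expect_mono fun x => ?_
    refine (le_abs_self _).trans ?_
    rw [abs_mul]
    refine mul_le_mul_of_nonneg_right ?_ (abs_nonneg _)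
    have := hf x
    rw [Set.mem_Icc] at this hE
    rw [abs_le]; constructor <;> linarith
  calc _ ≤ minMu B / 2 * (2 * expect fun x => |a x - α|) := by gcongr
    _ = expect fun x => minMu B * |a x - α| := by rw [expect_const_mul]; ring
    _ ≤ _ := by
      rw [covFun_eq_expect (ind B) a α, expect_ind]
      refine expect_mono fun x => ?_
      by_cases hx : x ∈ B
      · have := h1 x hx
        rw [abs_of_nonneg (by linarith), ind, if_pos hx]
        exact mul_le_mul_of_nonneg_right (min_le_right _ _) (by linarith)
      · have := h2 x hx
        rw [abs_of_nonpos (by linarith), ind, if_neg hx]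
        have : minMu B ≤ mu B := min_le_left _ _
        nlinarith

/-! ### Level-one bounds -/

/-- The normalized sum of the coordinates. -/
noncomputable def normSum (x : Cube n) : ℝ := signSum x / √n

theorem expect_exp_mul_normSum_le (c : ℝ) :
    expect (fun x : Cube n => Real.exp (c * normSum x)) ≤ Real.exp (c ^ 2 / 2) := by
  have e : (fun x : Cube n => Real.exp (c * normSum x)) =
      fun x => Real.exp (∑ j, c / √n * sgn (x j)) := by
    funext x
    rw [← mul_sum, normSum, signSum]
    congr 1; ring
  rw [e]
  refine (expect_exp_sum_le _).trans (Real.exp_le_exp.2 ?_)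
  rw [sum_const, card_univ, Fintype.card_fin, nsmul_eq_mul, div_pow, Real.sq_sqrt n.cast_nonneg]
  rcases Nat.eq_zero_or_pos n with h | h
  · subst h; simp; positivity
  · have : (0 : ℝ) < n := by exact_mod_cast h
    rw [mul_div_cancel₀ _ this.ne']

theorem expect_sgn (k : Fin n) : expect (fun x : Cube n => sgn (x k)) = 0 := by
  have h := expect_flip k fun x => sgn (x k)
  simp only [flip_apply_self, sgn_not, expect_neg] at h
  linarith

theorem expect_normSum : expect (normSum : Cube n → ℝ) = 0 := by
  have e : (normSum : Cube n → ℝ) = fun x => (∑ j, sgn (x j)) * (√n)⁻¹ := by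
    funext x; rw [normSum, signSum, div_eq_mul_inv]
  rw [e, expect_mul_const, expect_sum]
  simp [expect_sgn]

theorem le_add_exp {K z : ℝ} (hK : 1 ≤ K) : z ≤ K + Real.exp (K * z - K ^ 2) := by
  have h0 := Real.exp_pos (K * z - K ^ 2)
  rcases le_or_gt z K with h | h
  · linarith
  · have := Real.add_one_le_exp (K * z - K ^ 2)
    nlinarith

theorem expect_mul_normSum_le {h : Cube n → ℝ} (hh : ∀ x, h x ∈ Set.Icc (0 : ℝ) 1) {K ε : ℝ}
    (hK : 1 ≤ K) (hε : ε ^ 2 = 1) :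
    expect (fun x => h x * (ε * normSum x)) ≤ K * expect h + Real.exp (-(K ^ 2 / 2)) := by
  have h1 : expect (fun x => h x * (ε * normSum x)) ≤
      expect fun x => K * h x + Real.exp (K * ε * normSum x) * Real.exp (-K ^ 2) := by
    refine expect_mono fun x => ?_
    have h2 := le_add_exp (z := ε * normSum x) hK
    rw [← Real.exp_add, mul_assoc, ← sub_eq_add_neg]
    have h3 := Real.exp_pos (K * (ε * normSum x) - K ^ 2)
    have h4 := hh x
    rw [Set.mem_Icc] at h4
    nlinarith
  refine h1.trans ?_
  rw [expect_add, expect_const_mul, expect_mul_const]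
  gcongr
  refine (mul_le_mul_of_nonneg_right (expect_exp_mul_normSum_le _) (Real.exp_pos _).le).trans ?_
  rw [← Real.exp_add, mul_pow, hε]
  exact Real.exp_le_exp.2 (by linarith)

/-- As the normalized sum has mean zero, B with this sum and the complement of B with its negative
give the same expectation, so the smaller measure may be used. -/
theorem expect_ind_mul_normSum_le (B : Finset (Cube n)) {K : ℝ} (hK : 1 ≤ K) :
    expect (fun x => ind B x * normSum x) ≤ K * minMu B + Real.exp (-(K ^ 2 / 2)) := by
  have hi := ind_mem B
  have h1 := expect_mul_normSum_le hi hK (ε := 1) (by norm_num)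
  have h2 := expect_mul_normSum_le (h := fun x => 1 - ind B x) (fun x => by
    have := hi x; rw [Set.mem_Icc] at this ⊢; constructor <;> linarith) hK (ε := -1) (by norm_num)
  simp only [one_mul, expect_ind] at h1
  have e : (fun x => (1 - ind B x) * (-1 * normSum x)) =
      fun x => ind B x * normSum x - normSum x := by
    funext x; ring
  rw [e, expect_sub, expect_normSum, expect_sub, expect_const, expect_ind, sub_zero] at h2
  rcases min_choice (mu B) (1 - mu B) with h | h
  · rw [minMu, h]; exact h1
  · rw [minMu, h]; exact h2

theorem influenceFun_perm {f : Cube n → ℝ} (hf : FullySymmetricFun f)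
    (σ : Equiv.Perm (Fin n)) (k : Fin n) : influenceFun f (σ k) = influenceFun f k := by
  have e : ∀ x : Cube n, flip k (x ∘ σ) = flip (σ k) x ∘ σ := by
    intro x
    funext j
    by_cases hj : j = k
    · subst hj; simp [flip_apply_self]
    · rw [flip_apply_of_ne hj, Function.comp_apply, Function.comp_apply,
        flip_apply_of_ne (σ.injective.ne hj)]
  unfold influenceFun
  rw [← expect_comp_perm σ fun x => |f x - f (flip k x)|]
  simp only [e, hf σ]

theorem influenceFun_eq_of_symm {f : Cube n → ℝ} (hf : FullySymmetricFun f) (j k : Fin n) :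
    influenceFun f j = influenceFun f k := by
  rw [← influenceFun_perm hf (Equiv.swap k j) k, Equiv.swap_apply_left]

/-- The influence of a symmetric increasing function is its normalized first level weight. -/
theorem sqrt_mul_influenceFun {f : Cube n → ℝ} (hf : Monotone f) (hs : FullySymmetricFun f)
    (k : Fin n) : √n * influenceFun f k = 2 * expect fun x => f x * normSum x := by
  have hn : (0 : ℝ) < n := by exact_mod_cast k.pos
  have h1 : expect (fun x => f x * signSum x) = ∑ i, expect (deriv i f) := by
    simp only [signSum, mul_sum]
    rw [expect_sum]
    refine sum_congr rfl fun i _ => ?_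
    have := expect_mul_sgn_mul i f (fun _ => 1) fun _ => rfl
    simpa using this
  have h2 : 2 * expect (fun x => f x * signSum x) = n * influenceFun f k := by
    rw [h1, mul_sum]
    simp only [← influenceFun_eq hf, fun i => influenceFun_eq_of_symm hs i k]
    simp
  have e : (fun x => f x * normSum x) = fun x => f x * signSum x * (√(n : ℝ))⁻¹ := by
    funext x; rw [normSum]; ring
  rw [e, expect_mul_const, ← mul_assoc, h2]
  have h3 := Real.sq_sqrt hn.le
  have : 0 < √(n : ℝ) := Real.sqrt_pos.2 hn
  field_simp
  rw [h3, mul_comm]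

theorem sqrt_mul_influenceFun_le {f : Cube n → ℝ} (hf : Monotone f) (hs : FullySymmetricFun f)
    (h1 : ∀ x, f x ∈ Set.Icc (-1 : ℝ) 1) (k : Fin n) : √n * influenceFun f k ≤ 2 := by
  have hn : (0 : ℝ) < n := by exact_mod_cast k.pos
  rw [sqrt_mul_influenceFun hf hs]
  have h2 : expect (fun x => f x * normSum x) ≤
      expect fun x : Cube n => 1 / 2 + 1 / (2 * n) * signSum x ^ 2 := by
    refine expect_mono fun x => ?_
    have e : 1 / (2 * n) * signSum x ^ 2 = normSum x ^ 2 / 2 := by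
      rw [normSum, div_pow, Real.sq_sqrt hn.le]; field_simp
    rw [e]
    have := h1 x
    rw [Set.mem_Icc] at this
    nlinarith [sq_nonneg (f x - normSum x)]
  rw [expect_add, expect_const, expect_const_mul] at h2
  have h3 := mul_le_mul_of_nonneg_left (expect_sq_signSum (n := n))
    (by positivity : (0 : ℝ) ≤ 1 / (2 * n))
  have h4 : 1 / (2 * (n : ℝ)) * n = 1 / 2 := by field_simp
  linarith

/-! ### Decomposition of symmetric functions into families -/

/-- The family of the points with more than `t` coordinates equal to `1`. -/
def upper (n t : ℕ) : Finset (Cube n) := {x | t < weight x}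

theorem weight_mono : Monotone (weight : Cube n → ℕ) := by
  intro x y h
  refine card_le_card fun i => ?_
  simp only [mem_filter, mem_univ, true_and]
  intro hi
  have := h i
  rw [hi] at this
  exact eq_top_iff.2 this

theorem weight_comp_perm (σ : Equiv.Perm (Fin n)) (x : Cube n) : weight (x ∘ σ) = weight x := by
  unfold weight
  refine card_bij (fun i _ => σ i) (by simp) (fun _ _ _ _ h => σ.injective h) fun b hb => ?_
  exact ⟨σ.symm b, by simpa using hb, by simp⟩

theorem upper_increasing (n t : ℕ) : Increasing (upper n t) := by
  intro x y hx hxy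
  simp only [upper, mem_filter, mem_univ, true_and] at hx ⊢
  exact hx.trans_le (weight_mono hxy)

theorem upper_symm (n t : ℕ) : FullySymmetric (upper n t) := by
  intro σ x
  simp [upper, weight_comp_perm]

theorem exists_layers {f : Cube n → ℝ} (hf : Monotone f) (hs : FullySymmetricFun f)
    (h1 : ∀ x, f x ∈ Set.Icc (-1 : ℝ) 1) :
    ∃ (b : ℝ) (u : ℕ → ℝ), (∀ t, 0 ≤ u t) ∧ ∑ t ∈ range n, u t ≤ 2 ∧
      f = fun x => b + ∑ t ∈ range n, u t * ind (upper n t) x := by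
  -- An increasing chain of representatives, one for each weight; the layer coefficients are the
  -- increments of f along it.
  set p : ℕ → Cube n := fun k i => decide (i.val < k) with hp
  have hpm : Monotone p := by
    intro k l h i
    simp only [hp, Bool.le_iff_imp, decide_eq_true_eq]
    intro hi; omega
  have hpw : ∀ x : Cube n, weight (p (weight x)) = weight x := by
    intro x
    have := weight_le x
    simp only [hp, weight, decide_eq_true_eq]
    rw [Fin.card_filter_val_lt]
    exact min_eq_right this
  have hfp : ∀ x, f x = f (p (weight x)) := fun x =>
    le_antisymm (le_of_weight_le hf hs (hpw x).ge) (le_of_weight_le hf hs (hpw x).le)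
  refine ⟨f (p 0), fun t => f (p (t + 1)) - f (p t), fun t => ?_, ?_, ?_⟩
  · exact sub_nonneg.2 (hf (hpm (Nat.le_succ t)))
  · rw [sum_range_sub fun t => f (p t)]
    have := h1 (p n)
    have := h1 (p 0)
    rw [Set.mem_Icc] at *
    linarith
  · funext x
    have e : ∑ t ∈ range n, (f (p (t + 1)) - f (p t)) * ind (upper n t) x =
        ∑ t ∈ range (weight x), (f (p (t + 1)) - f (p t)) := by
      rw [← sum_filter_add_sum_filter_not (range n) fun t => t < weight x]
      have e1 : (range n).filter (fun t => t < weight x) = range (weight x) := by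
        have := weight_le x
        ext t
        simp only [mem_filter, mem_range]
        omega
      rw [e1]
      have e2 : ∑ t ∈ range n with ¬ t < weight x,
          (f (p (t + 1)) - f (p t)) * ind (upper n t) x = 0 := by
        refine sum_eq_zero fun t ht => ?_
        rw [mem_filter] at ht
        simp [ind, upper, ht.2]
      rw [e2, add_zero]
      refine sum_congr rfl fun t ht => ?_
      rw [mem_range] at ht
      simp [ind, upper, ht]
    rw [e, sum_range_sub fun t => f (p t), hfp x]
    ring

/-! ### The correlation inequality for bounded functions -/

theorem covFun_nonneg {f g : Cube n → ℝ} (hf : Monotone f) (hg : Monotone g) :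
    0 ≤ covFun f g := by
  rw [covFun_eq_corr, sub_nonneg]
  exact corr_mono hf hg fun j => by simp

theorem covFun_ge_of_symm {f g : Cube n → ℝ} (hf1 : ∀ x, f x ∈ Set.Icc (-1 : ℝ) 1)
    (hg1 : ∀ x, g x ∈ Set.Icc (-1 : ℝ) 1) (hf : Monotone f) (hg : Monotone g)
    (hs : FullySymmetricFun f) :
    1 / 1024 * ∑ i,
      (influenceFun f i / √(Real.log (Real.exp 1 ^ 3 / ((n : ℝ) * influenceFun f i ^ 2)))) *
      (influenceFun g i / √(Real.log (Real.exp 1 ^ 2 / influenceFun g i))) ≤ covFun f g := by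
  rcases Nat.eq_zero_or_pos n with hn | hn
  · subst hn
    simpa using covFun_nonneg hf hg
  have hn' : (0 : ℝ) < n := by exact_mod_cast hn
  have hsn : 0 < √(n : ℝ) := by positivity
  have hsq : √(n : ℝ) ^ 2 = n := Real.sq_sqrt hn'.le
  set k : Fin n := ⟨0, hn⟩
  set I := influenceFun f k with hI
  have hI0 : 0 ≤ I := influenceFun_nonneg f k
  have hIk : ∀ i, influenceFun f i = I := fun i => influenceFun_eq_of_symm hs i k
  simp only [hIk]
  rw [← mul_sum]
  set S := ∑ i, influenceFun g i / √(Real.log (Real.exp 1 ^ 2 / influenceFun g i)) with hS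
  have hS0 : 0 ≤ S := sum_nonneg fun i _ => div_nonneg (influenceFun_nonneg g i) (Real.sqrt_nonneg _)
  have hM := covFun_clip_ge hn hg hg1
  rw [← hS] at hM
  obtain ⟨b, u, hu0, hu2, hfu⟩ := exists_layers hf hs hf1
  set V := ∑ t ∈ range n, u t * minMu (upper n t) with hV
  have hV0 : 0 ≤ V := sum_nonneg fun t _ => mul_nonneg (hu0 t) (minMu_nonneg _)
  have hlin : ∀ h : Cube n → ℝ, covFun f h = ∑ t ∈ range n, u t * covFun (ind (upper n t)) h := by
    intro h
    have e : (fun x => f x * h x) = fun x =>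
        b * h x + ∑ t ∈ range n, u t * (ind (upper n t) x * h x) := by
      rw [hfu]
      funext x
      rw [add_mul, sum_mul]
      simp only [mul_assoc]
    rw [covFun, e, expect_add, expect_const_mul, expect_sum, hfu, expect_add, expect_const,
      expect_sum]
    simp only [expect_const_mul, covFun, mul_sub, sum_sub_distrib]
    rw [add_mul, sum_mul]
    simp only [mul_assoc]
    ring
  have hcov : V / 2 * covFun clip g ≤ covFun f g := by
    rw [hlin g, hV, sum_div, sum_mul]
    refine sum_le_sum fun t _ => ?_
    have := mul_le_mul_of_nonneg_left (covFun_ind_ge (upper_increasing n t) (upper_symm n t)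
      clip_mem clip_comp_perm hg) (hu0 t)
    linarith
  set s := √n * I with hs_def
  set L := Real.log (Real.exp 1 ^ 3 / (n * I ^ 2)) with hL
  have hns : n * I ^ 2 = s ^ 2 := by rw [hs_def, mul_pow, hsq]
  have hVs : s / (8 * √L) ≤ V := by
    rcases hI0.eq_or_lt with h0 | h0
    · rw [hs_def, ← h0]; simpa using hV0
    have hs0 : 0 < s := by positivity
    have hs2 : s ≤ 2 := sqrt_mul_influenceFun_le hf hs hf1 k
    have he := Real.exp_one_gt_d9
    have he3 : 16 ≤ Real.exp 1 ^ 3 := by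
      calc (16 : ℝ) ≤ 2.7 ^ 3 := by norm_num
        _ ≤ _ := by gcongr; linarith
    have hL1 : 1 ≤ L := by
      rw [hL, hns, Real.le_log_iff_exp_le (by positivity), le_div_iff₀ (by positivity)]
      have := Real.exp_one_lt_d9
      nlinarith
    have hsL := Real.one_le_sqrt.2 hL1
    set K := 2 * √L with hK
    -- With K = 2√L the error is (s²/e³)². Since the coefficients u sum to at most 2, s ≤ 2KV + s/2
    -- follows, and half of s is absorbed.
    have hexp : Real.exp (-(K ^ 2 / 2)) ≤ s / 8 := by
      have e : -(K ^ 2 / 2) = -L + -L := by rw [hK, mul_pow, Real.sq_sqrt (by linarith)]; ring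
      rw [e, Real.exp_add, Real.exp_neg, hL, Real.exp_log (by positivity), hns, inv_div,
        div_mul_div_comm, div_le_div_iff₀ (by positivity) (by norm_num)]
      have h3 : s ^ 3 ≤ 2 ^ 3 := by gcongr
      have h4 : s ^ 2 * s ^ 2 * 8 = s * (s ^ 3 * 8) := by ring
      rw [h4]
      refine mul_le_mul_of_nonneg_left ?_ hs0.le
      nlinarith
    have h1 : s = 2 * expect fun x => f x * normSum x := sqrt_mul_influenceFun hf hs k
    have h2 : expect (fun x => f x * normSum x) = covFun f normSum := by
      rw [covFun, expect_normSum]; ring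
    have h3 : covFun f normSum ≤ K * V + 2 * (s / 8) := by
      rw [hlin, hV, mul_sum]
      have h5 : ∀ t, covFun (ind (upper n t)) normSum ≤ K * minMu (upper n t) + s / 8 := by
        intro t
        rw [covFun, expect_normSum, mul_zero, sub_zero]
        have := expect_ind_mul_normSum_le (upper n t) (K := K) (by linarith)
        linarith
      calc _ ≤ ∑ t ∈ range n, u t * (K * minMu (upper n t) + s / 8) :=
            sum_le_sum fun t _ => mul_le_mul_of_nonneg_left (h5 t) (hu0 t)
        _ = ∑ t ∈ range n, K * (u t * minMu (upper n t)) + (∑ t ∈ range n, u t) * (s / 8) := by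
            rw [sum_mul, ← sum_add_distrib]
            refine sum_congr rfl fun t _ => ?_
            ring
        _ ≤ _ := by gcongr
    rw [div_le_iff₀ (by positivity)]
    rw [h2] at h1
    have : V * (8 * √L) = 4 * (K * V) := by rw [hK]; ring
    linarith
  calc 1 / 1024 * (I / √L * S) = s / (8 * √L) / 2 * (1 / (64 * √n) * S) := by
        rw [hs_def]; field_simp; ring
    _ ≤ V / 2 * covFun clip g := by gcongr
    _ ≤ _ := hcov

/-! ### Lower bounds for tails -/

theorem exp_sq_div_three_le_cosh {u : ℝ} (h : u ^ 2 ≤ 1) :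
    Real.exp (u ^ 2 / 3) ≤ Real.cosh u := by
  have h1 : 1 + u ^ 2 / 2 ≤ Real.cosh u := by
    have e : Real.cosh u = 1 + 2 * Real.sinh (u / 2) ^ 2 := by
      have h2 := Real.cosh_two_mul (u / 2)
      have h3 := Real.cosh_sq (u / 2)
      rw [mul_div_cancel₀ _ (two_ne_zero)] at h2
      linarith
    have h4 : |u / 2| ≤ |Real.sinh (u / 2)| := by
      rw [Real.abs_sinh]
      exact Real.self_le_sinh_iff.2 (abs_nonneg _)
    have h5 := sq_le_sq.2 h4
    rw [e]; linarith
  refine le_trans ?_ h1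
  have h6 := Real.add_one_le_exp (-(u ^ 2 / 3))
  have h7 : Real.exp (u ^ 2 / 3) * Real.exp (-(u ^ 2 / 3)) = 1 := by
    rw [← Real.exp_add, add_neg_cancel, Real.exp_zero]
  have h8 : Real.exp (u ^ 2 / 3) * (1 - u ^ 2 / 3) ≤ 1 := by
    rw [← h7]
    refine mul_le_mul_of_nonneg_left (by linarith) (Real.exp_pos _).le
  have h9 : 1 ≤ (1 + u ^ 2 / 2) * (1 - u ^ 2 / 3) := by nlinarith [sq_nonneg u]
  exact le_of_mul_le_mul_right (h8.trans h9) (by linarith)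

theorem exp_le_expect_exp_mul_normSum (hn : 0 < n) {c : ℝ} (h : c ^ 2 ≤ n) :
    Real.exp (c ^ 2 / 3) ≤ expect fun x : Cube n => Real.exp (c * normSum x) := by
  have hn' : (0 : ℝ) < n := by exact_mod_cast hn
  have e : (fun x : Cube n => Real.exp (c * normSum x)) =
      fun x => Real.exp (∑ j, c / √n * sgn (x j)) := by
    funext x
    rw [← mul_sum, normSum, signSum]
    congr 1; ring
  have h1 : (c / √n) ^ 2 = c ^ 2 / n := by rw [div_pow, Real.sq_sqrt hn'.le]
  rw [e, expect_exp_sum, prod_const, card_univ, Fintype.card_fin]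
  refine le_trans (le_of_eq ?_) (pow_le_pow_left₀ (Real.exp_pos _).le
    (exp_sq_div_three_le_cosh (u := c / √n) (by rw [h1]; exact (div_le_one hn').2 h)) n)
  rw [← Real.exp_nat_mul, h1]
  congr 1
  field_simp

theorem inv_two_pow_le_mu {U : Finset (Cube n)} (h : U.Nonempty) : (1 / 2 ^ n : ℝ) ≤ mu U := by
  unfold mu
  gcongr
  exact_mod_cast h.card_pos

/-- A family containing the points where a signed normalized sum exceeds `z` is not small. -/
theorem exp_le_mu (hn : 0 < n) {U : Finset (Cube n)} {ε z : ℝ} (hε : ε ^ 2 = 1) (hz : 1 ≤ z)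
    (hU : U.Nonempty) (h : ∀ x, x ∉ U → ε * normSum x ≤ z) :
    Real.exp (-(32 * z ^ 2)) ≤ mu U := by
  have hn' : (0 : ℝ) < n := by exact_mod_cast hn
  rcases le_or_gt ((4 * z) ^ 2) (n : ℝ) with hzn | hzn
  · have h1 := exp_le_expect_exp_mul_normSum hn (c := 4 * z * ε) (by rw [mul_pow, hε]; linarith)
    -- A second-moment argument: off U the integrand is at most exp(4z²), and on U the AM-GM
    -- inequality splits it. The moment at 4z is at least 2 exp(4z²), and the moment at 8z is at
    -- most exp(32z²), so U must carry mass.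
    have h2 : expect (fun x : Cube n => Real.exp (4 * z * ε * normSum x)) ≤
        expect fun x => Real.exp (4 * z ^ 2) +
          ((1 / 2) * (Real.exp (-(32 * z ^ 2)) * Real.exp (8 * z * ε * normSum x)) +
            (1 / 2) * (Real.exp (32 * z ^ 2) * ind U x)) := by
      refine expect_mono fun x => ?_
      have p1 := Real.exp_pos (4 * z ^ 2)
      by_cases hx : x ∈ U
      · have e1 : Real.exp (-(32 * z ^ 2)) * Real.exp (8 * z * ε * normSum x) =
            (Real.exp (-(16 * z ^ 2)) * Real.exp (4 * z * ε * normSum x)) ^ 2 := by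
          rw [← Real.exp_add, ← Real.exp_add, ← Real.exp_nat_mul]
          congr 1; push_cast; ring
        have e2 : Real.exp (32 * z ^ 2) = Real.exp (16 * z ^ 2) ^ 2 := by
          rw [← Real.exp_nat_mul]
          congr 1; push_cast; ring
        have e3 : Real.exp (4 * z * ε * normSum x) =
            (Real.exp (-(16 * z ^ 2)) * Real.exp (4 * z * ε * normSum x)) *
              Real.exp (16 * z ^ 2) := by
          rw [← Real.exp_add, ← Real.exp_add]
          congr 1; ring
        rw [e1, e2, ind, if_pos hx, mul_one]
        nth_rewrite 1 [e3]
        nlinarith [sq_nonneg ((Real.exp (-(16 * z ^ 2)) * Real.exp (4 * z * ε * normSum x)) -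
              Real.exp (16 * z ^ 2))]
      · have h3 := h x hx
        have : Real.exp (4 * z * ε * normSum x) ≤ Real.exp (4 * z ^ 2) :=
          Real.exp_le_exp.2 (by nlinarith)
        have p2 := Real.exp_pos (-(32 * z ^ 2))
        have p3 := Real.exp_pos (8 * z * ε * normSum x)
        have : 0 < Real.exp (-(32 * z ^ 2)) * Real.exp (8 * z * ε * normSum x) := by positivity
        rw [ind, if_neg hx]
        linarith
    rw [expect_add, expect_const, expect_add, expect_const_mul, expect_const_mul,
      expect_const_mul, expect_const_mul, expect_ind] at h2
    have h3 : Real.exp (-(32 * z ^ 2)) *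
        expect (fun x : Cube n => Real.exp (8 * z * ε * normSum x)) ≤ 1 := by
      refine (mul_le_mul_of_nonneg_left (expect_exp_mul_normSum_le _) (Real.exp_pos _).le).trans
        (le_of_eq ?_)
      rw [← Real.exp_add, mul_pow, hε, Real.exp_eq_one_iff]
      ring
    have h4 : 2 * Real.exp (4 * z ^ 2) ≤ Real.exp ((4 * z * ε) ^ 2 / 3) := by
      have e : (4 * z * ε) ^ 2 / 3 = 4 * z ^ 2 + 4 / 3 * z ^ 2 := by
        rw [mul_pow, hε]; ring
      rw [e, Real.exp_add, mul_comm]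
      refine mul_le_mul_of_nonneg_left ?_ (Real.exp_pos _).le
      have := Real.add_one_le_exp (4 / 3 * z ^ 2)
      nlinarith
    have h5 : 1 ≤ Real.exp (4 * z ^ 2) := Real.one_le_exp (by positivity)
    rw [Real.exp_neg, inv_le_iff_one_le_mul₀' (Real.exp_pos _)]
    linarith
  -- When n < 16z², a single point already has enough mass.
  · refine le_trans ?_ (inv_two_pow_le_mu hU)
    rw [Real.exp_neg, one_div]
    refine inv_anti₀ (by positivity) ?_
    calc (2 : ℝ) ^ n ≤ Real.exp 1 ^ n := by
          gcongr
          linarith [Real.exp_one_gt_d9]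
      _ = Real.exp n := by rw [← Real.exp_nat_mul, mul_one]
      _ ≤ _ := Real.exp_le_exp.2 (by nlinarith)

theorem mu_compl (U : Finset (Cube n)) : mu Uᶜ = 1 - mu U := by
  rw [mu, mu, card_compl]
  rw [Nat.cast_sub (card_le_univ U)]
  simp [sub_div]

/-! ### Lower bound for the level-one weight of a half-space -/

/-- As β ≥ 0, the distance is at least 1 wherever the signed sum is at most -1, an event of measure
at least exp(-32). -/
theorem expect_abs_sub_ge (hn : 0 < n) {ε β : ℝ} (hε : ε ^ 2 = 1) (hβ : 0 ≤ β) :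
    Real.exp (-32) ≤ expect fun x : Cube n => |ε * normSum x - β| := by
  have hsn : 1 ≤ √(n : ℝ) := Real.one_le_sqrt.2 (by exact_mod_cast hn)
  set V : Finset (Cube n) := {x | 1 ≤ -ε * normSum x} with hV
  have hVne : V.Nonempty := by
    have hc : ∀ b : Bool, normSum (fun _ : Fin n => b) = sgn b * √n := by
      intro b
      rw [normSum, signSum, sum_const, card_univ, Fintype.card_fin, nsmul_eq_mul, mul_comm,
        mul_div_assoc, Real.div_sqrt]
    rcases mul_self_eq_one_iff.1 ((sq ε).symm.trans hε) with h | h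
    · refine ⟨fun _ => false, ?_⟩
      simp [hV, hc, h, hsn]
    · refine ⟨fun _ => true, ?_⟩
      simp [hV, hc, h, hsn]
  have h1 := exp_le_mu hn (ε := -ε) (z := 1) (by rw [neg_sq, hε]) le_rfl hVne fun x hx => by
    simp only [hV, mem_filter, mem_univ, true_and, not_le] at hx
    exact hx.le
  norm_num at h1
  refine h1.trans ?_
  rw [← expect_ind]
  refine expect_mono fun x => ?_
  unfold ind
  split_ifs with hx
  · simp only [hV, mem_filter, mem_univ, true_and] at hx
    rw [abs_of_nonpos (by linarith)]
    linarith
  · positivity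

/-- With z = max(1, β), s is at least a constant times μ(1-μ)z, while the reverse Chernoff bound
gives s ≥ exp(-96z²), so the root of the logarithm is at most 14z. -/
theorem mul_sqrt_log_le (hn : 0 < n) {U : Finset (Cube n)} {ε β : ℝ} (hε : ε ^ 2 = 1)
    (hβ : 0 ≤ β) (hU : U.Nonempty) (hUc : Uᶜ.Nonempty) (h1 : ∀ x ∈ U, β ≤ ε * normSum x)
    (h2 : ∀ x, x ∉ U → ε * normSum x ≤ β) {s : ℝ}
    (hs : s = 2 * expect fun x => ind U x * (ε * normSum x)) :
    0 < s ∧ Real.exp (-32) / 7 * (mu U * (1 - mu U)) * √(Real.log (Real.exp 1 ^ 2 / s ^ 2)) ≤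
      s := by
  have hμ := mu_mem U
  rw [Set.mem_Icc] at hμ
  set μ := mu U with hμdef
  have hm0 : 0 ≤ μ * (1 - μ) := mul_nonneg hμ.1 (by linarith)
  have hmμ : μ * (1 - μ) ≤ μ := by nlinarith
  have s1 : 2 * (β * μ) ≤ s := by
    rw [hs, hμdef, ← expect_ind, ← expect_const_mul]
    refine mul_le_mul_of_nonneg_left (expect_mono fun x => ?_) zero_le_two
    unfold ind
    split_ifs with hx
    · linarith [h1 x hx]
    · simp
  have s2 : 2 * (Real.exp (-32) * (μ * (1 - μ))) ≤ s := by
    have hW : expect (fun x : Cube n => ε * normSum x) = 0 := by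
      rw [expect_const_mul, expect_normSum, mul_zero]
    have e : expect (fun x => ind U x * (ε * normSum x)) =
        covFun (ind U) fun x => ε * normSum x := by
      rw [covFun, hW]; ring
    rw [hs, e, covFun_eq_expect _ _ β, expect_ind]
    refine mul_le_mul_of_nonneg_left ?_ zero_le_two
    calc _ ≤ (expect fun x : Cube n => |ε * normSum x - β|) * (μ * (1 - μ)) := by
          gcongr
          exact expect_abs_sub_ge hn hε hβ
      _ = expect fun x : Cube n => |ε * normSum x - β| * (μ * (1 - μ)) := by
          rw [expect_mul_const]
      _ ≤ _ := by
          refine expect_mono fun x => ?_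
          by_cases hx : x ∈ U
          · have := h1 x hx
            rw [abs_of_nonneg (by linarith), ind, if_pos hx, mul_comm]
            refine mul_le_mul_of_nonneg_right ?_ (by linarith)
            nlinarith
          · have := h2 x hx
            rw [abs_of_nonpos (by linarith), ind, if_neg hx]
            nlinarith
  have hp := Real.exp_pos (-32)
  have hp1 : Real.exp (-32) ≤ 1 := Real.exp_le_one_iff.2 (by norm_num)
  obtain ⟨z, hz1, hz2, hz3⟩ : ∃ z : ℝ, 1 ≤ z ∧ Real.exp (-(96 * z ^ 2)) ≤ s ∧
      2 * (Real.exp (-32) * (μ * (1 - μ))) * z ≤ s := by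
    rcases le_total 1 β with hb | hb
    · refine ⟨β, hb, ?_, ?_⟩
      · have h3 := exp_le_mu hn hε hb hU h2
        have h4 : Real.exp (-(96 * β ^ 2)) ≤ Real.exp (-(32 * β ^ 2)) :=
          Real.exp_le_exp.2 (by nlinarith)
        nlinarith
      · refine le_trans ?_ s1
        have : Real.exp (-32) * (μ * (1 - μ)) ≤ μ := by nlinarith
        nlinarith
    · refine ⟨1, le_rfl, ?_, by linarith⟩
      have h3 := exp_le_mu hn hε le_rfl hU fun x hx => (h2 x hx).trans hb
      have h4 := exp_le_mu hn (ε := -ε) (by rw [neg_sq, hε]) le_rfl hUc fun x hx => by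
        have := h1 x (by simpa using hx)
        linarith
      rw [mu_compl] at h4
      norm_num at h3 h4
      refine le_trans ?_ s2
      have e : Real.exp (-(96 * 1 ^ 2)) = Real.exp (-32) * (Real.exp (-32) * Real.exp (-32)) := by
        rw [← Real.exp_add, ← Real.exp_add]; norm_num
      rw [e]
      have h5 : Real.exp (-32) * Real.exp (-32) ≤ μ * (1 - μ) :=
        mul_le_mul h3 h4 hp.le hμ.1
      have h6 := mul_le_mul_of_nonneg_left h5 hp.le
      have h7 := mul_nonneg hp.le hm0
      linarith
  have hs0 : 0 < s := (Real.exp_pos _).trans_le hz2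
  refine ⟨hs0, ?_⟩
  have hlog : Real.log (Real.exp 1 ^ 2 / s ^ 2) ≤ (14 * z) ^ 2 := by
    have h3 := (Real.le_log_iff_exp_le hs0).2 hz2
    rw [Real.log_div (by positivity) (by positivity), Real.log_pow, Real.log_pow, Real.log_exp]
    push_cast
    nlinarith
  have hsq : √(Real.log (Real.exp 1 ^ 2 / s ^ 2)) ≤ 14 * z :=
    (Real.sqrt_le_left (by linarith)).2 hlog
  calc _ ≤ Real.exp (-32) / 7 * (μ * (1 - μ)) * (14 * z) := by gcongr
    _ = 2 * (Real.exp (-32) * (μ * (1 - μ))) * z := by ring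
    _ ≤ s := hz3

theorem normSum_mono : Monotone (normSum : Cube n → ℝ) := by
  intro x y h
  unfold normSum
  have := signSum_mono h
  gcongr

theorem normSum_symm : FullySymmetricFun (normSum : Cube n → ℝ) := by
  intro σ x
  rw [normSum, signSum_comp_perm, normSum]

/-- The influences of a symmetric increasing family are at least those of a half-space. -/
theorem mu_mul_le_influenceFun {B : Finset (Cube n)} (hB : Increasing B) (hs : FullySymmetric B)
    (k : Fin n) : Real.exp (-32) / 7 * (mu B * (1 - mu B) / √n) ≤
      influenceFun (ind B) k /
        √(Real.log (Real.exp 1 ^ 2 / (n * influenceFun (ind B) k ^ 2))) := by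
  have hn := k.pos
  have hn' : (0 : ℝ) < n := by exact_mod_cast hn
  have hsn : 0 < √(n : ℝ) := Real.sqrt_pos.2 hn'
  set I := influenceFun (ind B) k with hI
  have hI0 : 0 ≤ I := influenceFun_nonneg _ _
  rcases B.eq_empty_or_nonempty with h | hne
  · have : mu B = 0 := by simp [h, mu]
    rw [this]; simp; positivity
  rcases Bᶜ.eq_empty_or_nonempty with h | hcne
  · have : 1 - mu B = 0 := by rw [← mu_compl, h]; simp [mu]
    rw [this]; simp; positivity
  set s := √n * I with hs_def
  have hns : n * I ^ 2 = s ^ 2 := by rw [hs_def, mul_pow, Real.sq_sqrt hn'.le]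
  have hsZ : s = 2 * expect fun x => ind B x * normSum x :=
    sqrt_mul_influenceFun (ind_mono hB) (ind_symm hs) k
  have hs2 : s ≤ 2 := sqrt_mul_influenceFun_le (ind_mono hB) (ind_symm hs)
    (fun x => ⟨by linarith [(ind_mem B x).1], (ind_mem B x).2⟩) k
  have hle : ∀ x ∈ B, ∀ y, y ∉ B → normSum y ≤ normSum x := fun x hx y hy =>
    le_of_weight_le normSum_mono normSum_symm (weight_lt_of_mem_of_notMem hB hs hx hy).le
  have key : 0 < s ∧ Real.exp (-32) / 7 * (mu B * (1 - mu B)) *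
      √(Real.log (Real.exp 1 ^ 2 / s ^ 2)) ≤ s := by
    obtain ⟨a, ha, hmin⟩ := exists_min_image B normSum hne
    obtain ⟨b, hb, hmax⟩ := exists_max_image Bᶜ normSum hcne
    rw [mem_compl] at hb
    -- A negative threshold is made nonnegative by passing to the complement and negating the sum; s
    -- and μ(1-μ) are unchanged.
    rcases le_or_gt 0 (normSum a) with h0 | h0
    · exact mul_sqrt_log_le hn (ε := 1) (by norm_num) h0 hne hcne
        (fun x hx => by rw [one_mul]; exact hmin x hx)
        (fun x hx => by rw [one_mul]; exact hle a ha x hx) (by simpa only [one_mul] using hsZ)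
    · have h1 := hle a ha b hb
      have e : (fun x => ind Bᶜ x * (-1 * normSum x)) =
          fun x => ind B x * normSum x - normSum x := by
        funext x
        by_cases hx : x ∈ B <;> simp [ind, hx]
      have := mul_sqrt_log_le hn (U := Bᶜ) (ε := -1) (β := -normSum b) (s := s) (by norm_num)
        (by linarith) hcne (by rwa [compl_compl])
        (fun x hx => by linarith [hmax x hx])
        (fun x hx => by
          rw [mem_compl, not_not] at hx
          linarith [hle x hx b hb])
        (by rw [e, expect_sub, expect_normSum, sub_zero, ← hsZ])
      rwa [mu_compl, sub_sub_cancel, mul_comm (1 - mu B)] at this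
  rw [hns]
  have hlog : 0 < Real.log (Real.exp 1 ^ 2 / s ^ 2) := by
    have := Real.exp_one_gt_d9
    have := key.1
    refine Real.log_pos ((one_lt_div (by positivity)).2 ?_)
    nlinarith
  have hsl := Real.sqrt_pos.2 hlog
  rw [le_div_iff₀ hsl]
  calc _ = (Real.exp (-32) / 7 * (mu B * (1 - mu B)) *
        √(Real.log (Real.exp 1 ^ 2 / s ^ 2))) / √n := by ring
    _ ≤ s / √n := by gcongr; exact key.2
    _ = I := by rw [hs_def]; field_simp

/-! ### Translation to families -/

theorem cov_eq_covFun (A B : Finset (Cube n)) : cov A B = covFun (ind B) (ind A) := by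
  rw [cov, covFun, expect_ind, expect_ind, ← expect_ind (A ∩ B), mul_comm (mu A)]
  congr 2
  funext x
  by_cases h1 : x ∈ A <;> by_cases h2 : x ∈ B <;> simp [ind, h1, h2]

theorem influence_eq (A : Finset (Cube n)) (k : Fin n) :
    influence A k = influenceFun (ind A) k := by
  set F := A.filter fun x => flip k x ∉ A with hF
  have e : (fun x => |ind A x - ind A (flip k x)|) = fun x => ind F x + ind F (flip k x) := by
    funext x
    by_cases h1 : x ∈ A <;> by_cases h2 : flip k x ∈ A <;> simp [ind, hF, h1, h2, flip_flip]
  rw [influence, influenceFun, e, expect_add, expect_flip, expect_ind, two_mul]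

theorem influence_mem (A : Finset (Cube n)) (k : Fin n) :
    influence A k ∈ Set.Icc (0 : ℝ) 1 := by
  rw [influence_eq]
  refine expect_mem fun x => ⟨abs_nonneg _, ?_⟩
  have h1 := ind_mem A x
  have h2 := ind_mem A (flip k x)
  rw [Set.mem_Icc] at h1 h2
  rw [abs_le]
  constructor <;> linarith

theorem div_sqrt_le_two_mul {a x y : ℝ} (ha : 0 ≤ a) (hx : 0 < x) (hy : 0 < y)
    (h : y ≤ 4 * x) : a / √x ≤ 2 * (a / √y) := by
  have h1 : √y ≤ 2 * √x := by
    rw [Real.sqrt_le_left (by positivity), mul_pow, Real.sq_sqrt hx.le]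
    linarith
  have := Real.sqrt_pos.2 hx
  have := Real.sqrt_pos.2 hy
  rw [← mul_div_assoc, div_le_div_iff₀ (by positivity) (by positivity)]
  nlinarith

theorem psi_nonneg {x : ℝ} (h : 0 ≤ x) : 0 ≤ psi x := div_nonneg h (Real.sqrt_nonneg _)

theorem psi_le {x : ℝ} (h0 : 0 ≤ x) (h1 : x ≤ 1) :
    psi x ≤ 2 * (x / √(Real.log (Real.exp 1 ^ 2 / x))) := by
  rcases h0.eq_or_lt with h | h
  · simp [← h, psi]
  have hl := Real.log_nonpos h.le h1
  refine div_sqrt_le_two_mul h0 ?_ ?_ ?_ <;>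
    simp only [Real.log_div (Real.exp_ne_zero 1) h.ne',
      Real.log_div (pow_ne_zero 2 (Real.exp_ne_zero 1)) h.ne', Real.log_pow, Real.log_exp] <;>
    push_cast <;> linarith

theorem influence_div_le {B : Finset (Cube n)} (hB : Increasing B) (hs : FullySymmetric B)
    (k : Fin n) :
    influenceFun (ind B) k / √(Real.log (Real.exp 1 ^ 2 / (n * influenceFun (ind B) k ^ 2))) ≤
      2 * (influenceFun (ind B) k /
        √(Real.log (Real.exp 1 ^ 3 / (n * influenceFun (ind B) k ^ 2)))) := by
  have hn' : (0 : ℝ) < n := by exact_mod_cast k.pos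
  have hsn : 0 < √(n : ℝ) := Real.sqrt_pos.2 hn'
  have hs2 : √n * influenceFun (ind B) k ≤ 2 :=
    sqrt_mul_influenceFun_le (ind_mono hB) (ind_symm hs)
      (fun x => ⟨by linarith [(ind_mem B x).1], (ind_mem B x).2⟩) k
  have hI0 := influenceFun_nonneg (ind B) k
  set I := influenceFun (ind B) k
  rcases hI0.eq_or_lt with h | h
  · simp [← h]
  have hw : n * I ^ 2 = (√n * I) ^ 2 := by rw [mul_pow, Real.sq_sqrt hn'.le]
  have hpos : 0 < √n * I := by positivity
  -- Any bound by 5/3 would give 3 - log ≤ 4(2 - log), which is what the factor 2 requires.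
  have hlog : Real.log (n * I ^ 2) ≤ 3 / 2 := by
    rw [hw, Real.log_le_iff_le_exp (by positivity)]
    have h1 : (√n * I) ^ 2 ≤ 2 ^ 2 := by gcongr
    refine h1.trans (le_of_sq_le_sq ?_ (Real.exp_pos _).le)
    rw [← Real.exp_nat_mul]
    have e : ((2 : ℕ) : ℝ) * (3 / 2) = ((3 : ℕ) : ℝ) * 1 := by norm_num
    rw [e, Real.exp_nat_mul]
    calc ((2 : ℝ) ^ 2) ^ 2 ≤ 2.7 ^ 3 := by norm_num
      _ ≤ _ := by
        gcongr
        linarith [Real.exp_one_gt_d9]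
  have hne : n * I ^ 2 ≠ 0 := by positivity
  have hexp : ∀ m : ℕ, Real.log (Real.exp 1 ^ m / (n * I ^ 2)) = m - Real.log (n * I ^ 2) := by
    intro m
    rw [Real.log_div (pow_ne_zero m (Real.exp_ne_zero 1)) hne, Real.log_pow, Real.log_exp, mul_one]
  refine div_sqrt_le_two_mul hI0 ?_ ?_ ?_ <;> simp only [hexp] <;> push_cast <;> linarith

theorem W1_self {B : Finset (Cube n)} (hs : FullySymmetric B) (k : Fin n) :
    W1 B B = n * influenceFun (ind B) k ^ 2 := by
  simp only [W1, influence_eq, fun i => influenceFun_eq_of_symm (ind_symm hs) i k]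
  simp [sq]

end DiscreteCube

theorem mainTheorem3 :
    (∃ c₁ c₂ : ℝ, 0 < c₁ ∧ 0 < c₂ ∧
      ∀ (n : ℕ) (A B : Finset (DiscreteCube.Cube n)),
        DiscreteCube.Increasing A → DiscreteCube.Increasing B →
        DiscreteCube.FullySymmetric B →
          DiscreteCube.cov A B ≥
            c₁ * ∑ i, DiscreteCube.psi (DiscreteCube.influence A i) *
              (DiscreteCube.influence B i /
                √(Real.log (Real.exp 1 ^ 2 / DiscreteCube.W1 B B))) ∧
          c₁ * ∑ i, DiscreteCube.psi (DiscreteCube.influence A i) *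
              (DiscreteCube.influence B i /
                √(Real.log (Real.exp 1 ^ 2 / DiscreteCube.W1 B B))) ≥
            c₂ * (DiscreteCube.mu B * (1 - DiscreteCube.mu B) / √(n : ℝ)) *
              ∑ i, DiscreteCube.psi (DiscreteCube.influence A i)) ∧
    (∃ c : ℝ, 0 < c ∧
      ∀ (n : ℕ) (f g : DiscreteCube.Cube n → ℝ),
        (∀ x, f x ∈ Set.Icc (-1 : ℝ) 1) → (∀ x, g x ∈ Set.Icc (-1 : ℝ) 1) →
        Monotone f → Monotone g → DiscreteCube.FullySymmetricFun f →
          DiscreteCube.covFun f g ≥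
            c * ∑ i,
              (DiscreteCube.influenceFun f i /
                √(Real.log (Real.exp 1 ^ 3 / ((n : ℝ) * DiscreteCube.influenceFun f i ^ 2)))) *
              (DiscreteCube.influenceFun g i /
                √(Real.log (Real.exp 1 ^ 2 / DiscreteCube.influenceFun g i)))) := by
  -- 4096 = 1024 · 2 · 2: each of the two changes of logarithm costs a factor 2.
  refine ⟨⟨1 / 4096, 1 / 4096 * (Real.exp (-32) / 7), by norm_num, by positivity, ?_⟩,
    1 / 1024, by norm_num, fun n f g hf1 hg1 hf hg hs =>
      DiscreteCube.covFun_ge_of_symm hf1 hg1 hf hg hs⟩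
  intro n A B hA hB hs
  have hind : ∀ C : Finset (DiscreteCube.Cube n), ∀ x,
      DiscreteCube.ind C x ∈ Set.Icc (-1 : ℝ) 1 := fun C x =>
    ⟨by linarith [(DiscreteCube.ind_mem C x).1], (DiscreteCube.ind_mem C x).2⟩
  constructor
  · rw [DiscreteCube.cov_eq_covFun]
    refine le_trans ?_ (DiscreteCube.covFun_ge_of_symm (hind B) (hind A)
      (DiscreteCube.ind_mono hB) (DiscreteCube.ind_mono hA) (DiscreteCube.ind_symm hs))
    rw [Finset.mul_sum, Finset.mul_sum]
    refine Finset.sum_le_sum fun i _ => ?_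
    have hI := DiscreteCube.influence_mem A i
    have h1 := DiscreteCube.psi_le hI.1 hI.2
    have h2 := DiscreteCube.influence_div_le hB hs i
    rw [DiscreteCube.W1_self hs i, DiscreteCube.influence_eq B]
    have h3 := mul_le_mul h1 h2 (div_nonneg (DiscreteCube.influenceFun_nonneg _ _)
      (Real.sqrt_nonneg _)) (mul_nonneg zero_le_two (div_nonneg hI.1 (Real.sqrt_nonneg _)))
    rw [DiscreteCube.influence_eq A] at h3 ⊢
    linarith
  · rw [ge_iff_le, Finset.mul_sum, Finset.mul_sum]
    refine Finset.sum_le_sum fun i _ => ?_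
    rw [DiscreteCube.W1_self hs i, DiscreteCube.influence_eq B]
    have h1 := DiscreteCube.mu_mul_le_influenceFun hB hs i
    have h2 := mul_le_mul_of_nonneg_left h1
      (DiscreteCube.psi_nonneg (DiscreteCube.influence_mem A i).1)
    linarith
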